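/- Let $k\ge 1$ be an integer, $m=4k+3$ and $\theta=2\pi/m$. Let $P$ be a finite set of points in the plane and let $S$ be a set of line segments (constraints) joining distinct points of $P$, no two of which intersect properly (that is, cross in a single point interior to both). Two distinct points $u,v\in P$ can see each other if the segment $uv$ does not properly intersect any constraint or is itself a constraint. Around each $u\in P$, the plane is divided into $m$ cones $C_0^u,\dots,C_{m-1}^u$ with apex $u$ and aperture $\theta$, numbered clockwise, such that the bisector of $C_0^u$ is the vertical halfline going up from $u$. Assume general position: no two points of $P$ lie on a line parallel to a ray bounding a cone, no two lie on a line perpendicular to the bisector of a cone, and no three are collinear. The lines through the constraints that join $u$ to points of $P$ in $C_i^u$ split $C_i^u$ into (closed) subcones; a cone that is not split is a single subcone. The constrained $\theta_m$-graph has vertex set $P$ and, for each subcone of each cone $C_i^u$ of each $u\in P$ that contains a point of $P$ that can see $u$, an edge from $u$ to the point $v$ in that subcone that can see $u$ whose orthogonal projection on the bisector of $C_i^u$ is closest to $u$. **Theorem.** Let $u,w\in P$ be distinct points that can see each other, and let $C_i^u$ be the cone of $u$ that contains $w$. Let $T_{uw}$ be the triangle bounded by the two rays bounding $C_i^u$ and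 the line through $w$ perpendicular to the bisector of $C_i^u$, let $m_{uw}$ be the midpoint of the side of $T_{uw}$ opposite $u$, and let $\alpha$ be the unsigned angle between $uw$ and $um_{uw}$. Then there is a path between $u$ and $w$ in the constrained $\theta_{4k+3}$-graph whose total Euclidean length is at most $$\left(\frac{\cos\alpha}{\cos(\theta/2)}+\frac{\bigl(\cos\alpha\,\tan(\theta/2)+\sin\alpha\bigr)\cos(\theta/4)}{\cos(\theta/2)-\sin(3\theta/4)}\right)\cdot|uw|.$$ -/

import Mathlib

namespace ConstrainedTheta

/-- The Euclidean plane; coordinate `0` is horizontal, coordinate `1` is vertical. -/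
abbrev Plane : Type := EuclideanSpace ℝ (Fin 2)

/-! ### Visibility -/

/-- The line segments `ab` and `cd` intersect properly: they cross in a single point that is
interior to both of them. -/
def ProperlyIntersect (a b c d : Plane) : Prop :=
  ∃ p : Plane, openSegment ℝ a b ∩ openSegment ℝ c d = {p}

/-- A set of constraints on the vertex set `P` is a set of unordered pairs of distinct points of
`P` (a simple graph on `P`, drawn with straight line segments). It is planar if no two constraints
intersect properly. -/
def PlanarConstraints {P : Finset Plane} (S : SimpleGraph P) : Prop :=
  ∀ a b c d : P, S.Adj a b → S.Adj c d → ¬ ProperlyIntersect a b c d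

/-- The visibility graph `Vis(P, S)`: distinct `u` and `v` see each other if and only if either the
segment `uv` does not properly intersect any constraint or `uv` is itself a constraint. -/
def visibilityGraph {P : Finset Plane} (S : SimpleGraph P) : SimpleGraph P where
  Adj u v := u ≠ v ∧
    ((∀ a b : P, S.Adj a b → ¬ ProperlyIntersect u v a b) ∨ S.Adj u v)
  symm := ⟨by
    rintro u v ⟨hne, h⟩
    refine ⟨hne.symm, h.imp (fun h a b hab => ?_) (fun h => h.symm)⟩
    have := h a b hab
    unfold ProperlyIntersect at this ⊢
    rwa [openSegment_symm ℝ (v : Plane) u]⟩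
  loopless := ⟨fun _ h => h.1 rfl⟩

/-! ### Cones and subcones; there are `m` cones around each point -/

/-- The aperture `θ = 2π / m` of a cone. -/
noncomputable def aperture (m : ℕ) : ℝ := 2 * Real.pi / m

/-- The unit vector at clockwise angle `φ` from the upward vertical direction. -/
noncomputable def dir (φ : ℝ) : Plane := !₂[Real.sin φ, Real.cos φ]

/-- The direction of the bisector of the `i`-th cone. Cone `0` has the upward vertical bisector, and
the cones are numbered clockwise. -/
noncomputable def bisector (m : ℕ) (i : Fin m) : Plane := dir (((i : ℕ) : ℝ) * aperture m)

/-- The direction of the counterclockwise boundary ray of the `i`-th cone. -/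
noncomputable def leftRay (m : ℕ) (i : Fin m) : Plane :=
  dir (((i : ℕ) : ℝ) * aperture m - aperture m / 2)

/-- The direction of the clockwise boundary ray of the `i`-th cone. -/
noncomputable def rightRay (m : ℕ) (i : Fin m) : Plane :=
  dir (((i : ℕ) : ℝ) * aperture m + aperture m / 2)

/-- The cone `C_i^u`: the region between its two boundary rays, which originate from `u`. -/
def cone (m : ℕ) (i : Fin m) (u : Plane) : Set Plane :=
  {p | ∃ s t : ℝ, 0 ≤ s ∧ 0 ≤ t ∧ p = u + s • leftRay m i + t • rightRay m i}

/-- The cross product of `v - u` and `p - u`. It vanishes exactly if `p` lies on the line through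
`u` and `v` (when `u ≠ v`), and its sign tells the two sides of that line apart. -/
def cross (u v p : Plane) : ℝ :=
  (v 0 - u 0) * (p 1 - u 1) - (v 1 - u 1) * (p 0 - u 0)

/-- `A` is one of the (closed) subcones into which `C_i^u` is split by the lines through the
constraints that join `u` to a vertex in `C_i^u`: the points of the cone on the same closed side
of each of these lines as some point `q` of the cone that lies on none of them. -/
def IsSubcone {P : Finset Plane} (m : ℕ) (S : SimpleGraph P) (u : P) (i : Fin m)
    (A : Set Plane) : Prop :=
  ∃ q ∈ cone m i u,
    (∀ v : P, S.Adj u v → (v : Plane) ∈ cone m i u → cross u v q ≠ 0) ∧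
    A = {p | p ∈ cone m i u ∧ ∀ v : P, S.Adj u v → (v : Plane) ∈ cone m i u →
      0 ≤ cross u v q * cross u v p}

/-! ### The constrained `θ_m`-graph -/

/-- The orthogonal projection of `p` on the line through `u` that contains the bisector of
`C_i^u`. -/
noncomputable def bisectorProj (m : ℕ) (i : Fin m) (u p : Plane) : Plane :=
  u + inner ℝ (bisector m i) (p - u) • bisector m i

/-- `u` adds an edge to `v`: in some subcone of `u`, the vertex `v` is a closest vertex that can see
`u`, where distance is measured along the bisector of the original cone. -/
def AddsEdge {P : Finset Plane} (m : ℕ) (S : SimpleGraph P) (u v : P) : Prop :=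
  ∃ (i : Fin m) (A : Set Plane), IsSubcone m S u i A ∧
    (v : Plane) ∈ A ∧ (visibilityGraph S).Adj u v ∧
    ∀ w : P, (w : Plane) ∈ A → (visibilityGraph S).Adj u w →
      dist (u : Plane) (bisectorProj m i u v) ≤ dist (u : Plane) (bisectorProj m i u w)

/-- The constrained `θ_m`-graph of `P` with respect to the constraints `S`. -/
def thetaGraph {P : Finset Plane} (m : ℕ) (S : SimpleGraph P) : SimpleGraph P where
  Adj u v := AddsEdge m S u v ∨ AddsEdge m S v u
  symm := ⟨fun _ _ h => h.symm⟩
  loopless := ⟨fun u h => by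
    obtain ⟨_, _, _, _, h, _⟩ | ⟨_, _, _, _, h, _⟩ := h <;> exact h.1 rfl⟩

/-- The length of a walk: the sum of the Euclidean lengths of its edges. -/
noncomputable def walkLength {P : Finset Plane} {G : SimpleGraph P} {u w : P}
    (p : G.Walk u w) : ℝ :=
  (p.darts.map fun d => dist (d.fst : Plane) (d.snd : Plane)).sum

/-- General position with respect to `m` cones. -/
structure GeneralPosition (m : ℕ) (P : Finset Plane) : Prop where
  /-- No two points lie on a line parallel to a ray that bounds a cone. -/
  not_parallel_ray : ∀ u ∈ P, ∀ v ∈ P, u ≠ v → ∀ i : Fin m, ∀ t : ℝ,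
    v - u ≠ t • leftRay m i ∧ v - u ≠ t • rightRay m i
  /-- No two points lie on a line perpendicular to the bisector of a cone. -/
  not_perp_bisector : ∀ u ∈ P, ∀ v ∈ P, u ≠ v → ∀ i : Fin m,
    inner ℝ (bisector m i) (v - u) ≠ 0
  /-- No three points are collinear. -/
  not_collinear : ∀ a ∈ P, ∀ b ∈ P, ∀ c ∈ P, a ≠ b → a ≠ c → b ≠ c →
    ¬ Collinear ℝ ({a, b, c} : Set Plane)

/-! ### The canonical triangle of `u` and a point `w` in `C_i^u`

It is bounded by the two boundary rays of `C_i^u` and the line through `w` perpendicular to the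
bisector of `C_i^u`. Its corners are `u` and the points where that line meets the two rays. -/

/-- The corner on the counterclockwise boundary ray. -/
noncomputable def leftCorner (m : ℕ) (i : Fin m) (u w : Plane) : Plane :=
  u + (inner ℝ (bisector m i) (w - u) / Real.cos (aperture m / 2)) • leftRay m i

/-- The corner on the clockwise boundary ray. -/
noncomputable def rightCorner (m : ℕ) (i : Fin m) (u w : Plane) : Plane :=
  u + (inner ℝ (bisector m i) (w - u) / Real.cos (aperture m / 2)) • rightRay m i

/-- The midpoint of the side of the canonical triangle opposite `u`. -/
noncomputable def oppositeMidpoint (m : ℕ) (i : Fin m) (u w : Plane) : Plane :=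
  midpoint ℝ (leftCorner m i u w) (rightCorner m i u w)

theorem inner_dir_dir (φ ψ : ℝ) : inner ℝ (dir φ) (dir ψ) = Real.cos (φ - ψ) := by
  simp [dir, PiLp.inner_apply, Fin.sum_univ_two, Real.cos_sub]
  ring

/-- The left corner lies on the line through `w` perpendicular to the bisector. -/
theorem inner_leftCorner_sub {m : ℕ} (hm : Real.cos (aperture m / 2) ≠ 0) (i : Fin m)
    (u w : Plane) : inner ℝ (bisector m i) (leftCorner m i u w - w) = 0 := by
  have h : leftCorner m i u w - w = (inner ℝ (bisector m i) (w - u) /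
      Real.cos (aperture m / 2)) • leftRay m i - (w - u) := by
    unfold leftCorner; abel
  have h2 : inner ℝ (bisector m i) (leftRay m i) = Real.cos (aperture m / 2) := by
    rw [bisector, leftRay, inner_dir_dir]; congr 1; ring
  rw [h, inner_sub_right, inner_smul_right, h2, div_mul_cancel₀ _ hm, sub_self]

/-- The right corner lies on the line through `w` perpendicular to the bisector. -/
theorem inner_rightCorner_sub {m : ℕ} (hm : Real.cos (aperture m / 2) ≠ 0) (i : Fin m)
    (u w : Plane) : inner ℝ (bisector m i) (rightCorner m i u w - w) = 0 := by
  have h : rightCorner m i u w - w = (inner ℝ (bisector m i) (w - u) /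
      Real.cos (aperture m / 2)) • rightRay m i - (w - u) := by
    unfold rightCorner; abel
  have h2 : inner ℝ (bisector m i) (rightRay m i) = Real.cos (aperture m / 2) := by
    rw [bisector, rightRay, inner_dir_dir, ← Real.cos_neg]; congr 1; ring
  rw [h, inner_sub_right, inner_smul_right, h2, div_mul_cancel₀ _ hm, sub_self]

end ConstrainedTheta

namespace ConstrainedTheta


/-! ### Orientation -/

/-! Relative to a cone of `u`, describe a displacement by its height y along the bisector and its
signed width x. With c = `stretch θ`, `lengthBound` is y / cos(θ/2) + c (y tan(θ/2) + x): a side of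
the canonical triangle plus c times the distance from its left corner to the endpoint. It is linear
in (y, x), so bounds of consecutive displacements add up. For x = |X| it is the claimed bound, which
is proved for all visible pairs and cones by induction on the height of the canonical triangle.

Let `v` be the vertex to which `u` adds an edge in a subcone containing `w`. If `v ≠ w`, the sign
`o` reflects the picture so that `v` is to the left of `w` as seen from `u`. By `exists_closest`, no
constraint at `u` ends inside the angle `w u v`, and no vertex in it is below `v`. Gift wrapping
with `exists_next` then gives a convex chain from `v` to `w` that climbs, turns only left, and
consists of visibility edges.

The induction hypothesis applies to each chain edge. An edge climbing to the left stays in cone `i`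
of its start (`mul_sub_le`). An edge climbing to the right may lie in another cone `j`, but by
`exists_cone_bound` its bound there is no worse and its triangle is smaller. This is where c and the
form 4k+3 matter: (k+1)θ = π/2 + θ/4. The rightward edges telescope to x. By convexity the chain
turns left at most once, and then x may be replaced by -x because the turning vertex is not to the
right of `u` (`reach_of_chain`). -/

theorem cross_combo (u v a b : Plane) {s t : ℝ} (h : s + t = 1) :
    cross u v (s • a + t • b) = s * cross u v a + t * cross u v b := by
  obtain rfl : s = 1 - t := by linarith
  simp only [cross, PiLp.add_apply, PiLp.smul_apply, smul_eq_mul]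
  ring

theorem cross_ne_zero {m : ℕ} {P : Finset Plane} (hP : GeneralPosition m P) {a b c : Plane}
    (ha : a ∈ P) (hb : b ∈ P) (hc : c ∈ P) (hab : a ≠ b) (hac : a ≠ c) (hbc : b ≠ c) :
    cross a b c ≠ 0 := by
  intro h
  refine hP.not_collinear a ha b hb c hc hab hac hbc ?_
  rw [collinear_iff_of_mem (p₀ := a) (by simp)]
  refine ⟨b - a, ?_⟩
  have hne : b 0 - a 0 ≠ 0 ∨ b 1 - a 1 ≠ 0 := by
    by_contra! hh
    apply hab
    ext i
    fin_cases i
    · simpa using (sub_eq_zero.1 hh.1).symm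
    · simpa using (sub_eq_zero.1 hh.2).symm
  have key : ∃ r : ℝ, c = r • (b - a) +ᵥ a := by
    unfold cross at h
    rcases hne with h0 | h1
    · refine ⟨(c 0 - a 0) / (b 0 - a 0), ?_⟩
      ext i
      fin_cases i
      · simp [div_mul_cancel₀ _ h0]
      · simp only [vadd_eq_add, Fin.mk_one, PiLp.add_apply, PiLp.smul_apply, PiLp.sub_apply,
          smul_eq_mul, Fin.isValue]
        field_simp
        linear_combination h
    · refine ⟨(c 1 - a 1) / (b 1 - a 1), ?_⟩
      ext i
      fin_cases i
      · simp only [vadd_eq_add, Fin.zero_eta, PiLp.add_apply, PiLp.smul_apply, PiLp.sub_apply,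
          smul_eq_mul, Fin.isValue]
        field_simp
        linear_combination -h
      · simp [div_mul_cancel₀ _ h1]
  intro p hp
  simp only [Set.mem_insert_iff, Set.mem_singleton_iff] at hp
  rcases hp with rfl | rfl | rfl
  · exact ⟨0, by simp⟩
  · exact ⟨1, by simp⟩
  · exact key

/-- The orientation of `a, b, c`, up to a global sign `o`. -/
def orient (o : ℝ) (a b c : Plane) : ℝ := o * cross a b c

theorem orient_combo (o : ℝ) (u v a b : Plane) {s t : ℝ} (h : s + t = 1) :
    orient o u v (s • a + t • b) = s * orient o u v a + t * orient o u v b := by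
  rw [orient, cross_combo u v a b h, orient, orient]; ring

theorem orient_swap (o : ℝ) (a b c : Plane) : orient o a c b = - orient o a b c := by
  simp only [orient, cross]; ring

theorem orient_combo_mid (o : ℝ) (u a b v : Plane) {s t : ℝ} (h : s + t = 1) :
    orient o u (s • a + t • b) v = s * orient o u a v + t * orient o u b v := by
  rw [orient_swap, orient_combo _ _ _ _ _ h, orient_swap o u v a, orient_swap o u v b]
  ring

theorem orient_neg (o : ℝ) (a b c : Plane) : orient (-o) a b c = - orient o a b c := by
  simp only [orient]; ring

theorem orient_self_right (o : ℝ) (a b : Plane) : orient o a b b = 0 := by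
  simp only [orient, cross]; ring

theorem orient_self_left (o : ℝ) (a b : Plane) : orient o a b a = 0 := by
  simp only [orient, cross]; ring

theorem orient_ne_zero {m : ℕ} {P : Finset Plane} (hP : GeneralPosition m P) {o : ℝ} (ho : o ≠ 0)
    {a b c : P} (hab : a ≠ b) (hac : a ≠ c) (hbc : b ≠ c) : orient o a b c ≠ 0 :=
  mul_ne_zero ho (cross_ne_zero hP a.2 b.2 c.2 (Subtype.coe_injective.ne hab)
    (Subtype.coe_injective.ne hac) (Subtype.coe_injective.ne hbc))

/-- A function that is affine along segments. -/
def IsAffine (l : Plane → ℝ) : Prop :=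
  ∀ (a b : Plane) (s t : ℝ), s + t = 1 → l (s • a + t • b) = s * l a + t * l b

theorem isAffine_orient (o : ℝ) (u v : Plane) : IsAffine (orient o u v) :=
  fun a b _ _ h => orient_combo o u v a b h

theorem IsAffine.neg {l : Plane → ℝ} (hl : IsAffine l) : IsAffine fun p => - l p := by
  intro a b s t h
  simp only [hl a b s t h]; ring

/-! ### Proper intersections and visibility -/

theorem properlyIntersect_of_mem {a b c d r : Plane} (hr : r ∈ openSegment ℝ a b)
    (hr' : r ∈ openSegment ℝ c d) (h : cross c d a ≠ 0) : ProperlyIntersect c d a b := by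
  have hline : ∀ p ∈ openSegment ℝ c d, cross c d p = 0 := by
    rintro _ ⟨s, t, -, -, hst, rfl⟩
    rw [cross_combo _ _ _ _ hst]
    simp only [cross]; ring
  refine ⟨r, Set.Subset.antisymm ?_ (by rintro _ rfl; exact ⟨hr', hr⟩)⟩
  rintro p ⟨hp, hp'⟩
  have h1 := hline r hr'
  have h2 := hline p hp
  obtain ⟨s, t, hs, ht, hst, rfl⟩ := hr
  obtain ⟨s', t', hs', ht', hst', rfl⟩ := hp'
  rw [cross_combo _ _ _ _ hst] at h1
  rw [cross_combo _ _ _ _ hst'] at h2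
  have : t = t' := by
    obtain rfl : s = 1 - t := by linarith
    obtain rfl : s' = 1 - t' := by linarith
    have : (t' - t) * cross c d a = 0 := by
      linear_combination t' * h1 - t * h2
    rcases mul_eq_zero.1 this with h3 | h3
    · linarith
    · exact absurd h3 h
  subst this
  obtain rfl : s = s' := by linarith
  rfl

theorem not_properlyIntersect_self {a b : Plane} (hab : a ≠ b) : ¬ ProperlyIntersect a b a b := by
  rintro ⟨p, hp⟩
  rw [Set.inter_self] at hp
  have h1 : (1 / 2 : ℝ) • a + (1 / 2 : ℝ) • b ∈ openSegment ℝ a b :=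
    ⟨1 / 2, 1 / 2, by norm_num, by norm_num, by norm_num, rfl⟩
  have h2 : (1 / 3 : ℝ) • a + (2 / 3 : ℝ) • b ∈ openSegment ℝ a b :=
    ⟨1 / 3, 2 / 3, by norm_num, by norm_num, by norm_num, rfl⟩
  rw [hp, Set.mem_singleton_iff] at h1 h2
  apply hab
  have h3 := h1.trans h2.symm
  ext i
  have h4 := congrArg (fun q : Plane => q i) h3
  simp only [PiLp.add_apply, PiLp.smul_apply, smul_eq_mul] at h4
  linarith

/-- No constraint properly intersects the segment `xy`. -/
def Clear {P : Finset Plane} (S : SimpleGraph P) (x y : Plane) : Prop :=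
  ∀ a b : P, S.Adj a b → ¬ ProperlyIntersect x y a b

/-- Planarity makes a constraint itself uncrossed, so the second alternative in the definition of
visibility is absorbed by the first. -/
theorem visible_iff {P : Finset Plane} {S : SimpleGraph P} (hS : PlanarConstraints S) {u v : P} :
    (visibilityGraph S).Adj u v ↔ u ≠ v ∧ Clear S u v := by
  constructor
  · rintro ⟨hne, h | h⟩
    · exact ⟨hne, h⟩
    · exact ⟨hne, fun a b hab => hS u v a b h hab⟩
  · rintro ⟨hne, h⟩
    exact ⟨hne, Or.inl h⟩

/-- `p` lies strictly inside the angle at `u` that is bounded by the rays through `w` and `v`. -/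
def InAngle (o : ℝ) (u w v p : Plane) : Prop := 0 < orient o u w p ∧ 0 < orient o u p v

/-- No constraint at `u` ends strictly inside the angle `w u v`. -/
def NoConstraintIn {P : Finset Plane} (S : SimpleGraph P) (o : ℝ) (u w v : P) : Prop :=
  ∀ b : P, S.Adj u b → ¬ InAngle o u w v b

section Visibility

variable {m : ℕ} {P : Finset Plane} {S : SimpleGraph P} {o : ℝ} {u v w a b : P} {q : Plane}
  {l : Plane → ℝ}

/-- A constraint cannot leave the angle `w u v` through the segment `uw`. -/
theorem false_of_exit (hP : GeneralPosition m P) (ho : o ≠ 0) (hab : S.Adj a b)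
    (hq : q ∈ openSegment ℝ (a : Plane) b) (hl : IsAffine l) (hlu : 0 ≤ l u) (hlw : l w ≤ 0)
    (hlq : 0 ≤ l q) (hla : 0 < l a) (hc : Clear S u w) (huw : u ≠ w)
    (hv : 0 < orient o u w v) (hfq : 0 < orient o u w q) (hfa : orient o u w a ≤ 0)
    (hK : 0 < orient o u q v * (- orient o u w a) + orient o u w q * orient o u a v) :
    False := by
  set f := orient o u w with hf
  have hden : 0 < f q - f a := by linarith
  -- `r` is the point where the way from `q` to `a` meets the line `uw`. Up to a positive factor,
  -- the quantity in `hK` is `orient o u r v`, so `r` is on the ray from `u` towards `w`.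
  set τ := f q / (f q - f a) with hτ
  have hτ0 : 0 < τ := div_pos hfq hden
  have hτ1 : τ ≤ 1 := (div_le_one hden).2 (by linarith)
  set r : Plane := (1 - τ) • q + τ • (a : Plane) with hr
  have hfr : f r = 0 := by
    rw [hr, hf, orient_combo _ _ _ _ _ (by ring), ← hf, hτ]
    field_simp
    ring
  have hgr : 0 < orient o u r v := by
    have : orient o u r v = (1 - τ) * orient o u q v + τ * orient o u a v := by
      rw [hr, orient_combo_mid _ _ _ _ _ (by ring)]
    have h2 : (f q - f a) * orient o u r v =
        orient o u q v * (- f a) + f q * orient o u a v := by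
      rw [this, hτ]; field_simp; ring
    have h3 : 0 < (f q - f a) * orient o u r v := by rw [h2]; exact hK
    exact (mul_pos_iff_of_pos_left hden).1 h3
  set ρ := orient o u r v / orient o u w v with hρ
  have hρ0 : 0 < ρ := div_pos hgr hv
  have hrw : (1 - ρ) • (u : Plane) + ρ • (w : Plane) = r := by
    have hv' := hv.ne'
    have hid : ∀ i, orient o u w v * (r i - (u : Plane) i) =
        orient o u r v * ((w : Plane) i - (u : Plane) i) + f r * ((v : Plane) i - (u : Plane) i) := by
      intro i
      fin_cases i <;> simp only [hf, orient, cross, Fin.zero_eta, Fin.mk_one] <;> ring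
    ext i
    have := hid i
    rw [hfr] at this
    have hρe : orient o u w v * ρ = orient o u r v := mul_div_cancel₀ _ hv'
    apply mul_left_cancel₀ hv'
    simp only [PiLp.add_apply, PiLp.smul_apply, smul_eq_mul]
    linear_combination ((w : Plane) i - (u : Plane) i) * hρe - this
  -- `l` is positive at `r` and nonpositive at `w`, so `r` comes before `w` and is interior to the
  -- segment `uw`.
  have hlr : 0 < l r := by
    rw [hr, hl _ _ _ _ (by ring)]
    nlinarith
  have hρ1 : ρ < 1 := by
    by_contra! h
    rw [← hrw, hl _ _ _ _ (by ring)] at hlr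
    nlinarith
  have hro : r ∈ openSegment ℝ (u : Plane) w :=
    ⟨1 - ρ, ρ, by linarith, hρ0, by ring, hrw⟩
  -- By general position `a` could lie on the line `uw` only as `u` or `w`; both are excluded. Hence
  -- the crossing is proper.
  have hau : f a ≠ 0 := by
    intro h0
    have hτ' : τ = 1 := by rw [hτ, h0, sub_zero, div_self hfq.ne']
    have har : (a : Plane) = r := by rw [hr, hτ']; simp
    have h1 : a ≠ u := by
      rintro rfl
      rw [← har] at hgr
      simp [orient, cross] at hgr
    have h2 : a ≠ w := by
      rintro rfl
      linarith
    exact orient_ne_zero hP ho huw h1.symm h2.symm h0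
  have hτ2 : τ < 1 := (div_lt_one hden).2 (by
    have := lt_of_le_of_ne hfa hau; linarith)
  have hrab : r ∈ openSegment ℝ (a : Plane) b := by
    obtain ⟨s, t, hs, ht, hst, rfl⟩ := hq
    refine ⟨(1 - τ) * s + τ, (1 - τ) * t, by nlinarith, by nlinarith, by
      linear_combination (1 - τ) * hst, ?_⟩
    rw [hr]; module
  refine hc a b hab (properlyIntersect_of_mem hrab hro ?_)
  intro h0
  apply hau
  rw [hf, orient, h0, mul_zero]

/-- A constraint through a point strictly inside the angle `w u v` cannot leave the angle before it
reaches the line `l = 0`, which separates `u` from `v` and `w`. -/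
theorem inAngle_of_constraint (hP : GeneralPosition m P) (ho : o ≠ 0) (hab : S.Adj a b)
    (hq : q ∈ openSegment ℝ (a : Plane) b) (hqa : InAngle o u w v q) (hl : IsAffine l)
    (hlu : 0 ≤ l u) (hlw : l w ≤ 0) (hlv : l v ≤ 0) (hlq : 0 ≤ l q) (hla : 0 < l a)
    (hcw : Clear S u w) (hcv : Clear S u v) (huw : u ≠ w) (huv : u ≠ v)
    (hv : 0 < orient o u w v) (hno : NoConstraintIn S o u w v) : InAngle o u w v a := by
  by_contra hout
  obtain ⟨hfq, hgq⟩ := hqa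
  have hq' := hq
  obtain ⟨s, t, hs, ht, hst, hqe⟩ := hq'
  have hfq' : orient o u w q = s * orient o u w a + t * orient o u w b := by
    rw [← hqe, orient_combo _ _ _ _ _ hst]
  have hgq' : orient o u q v = s * orient o u a v + t * orient o u b v := by
    rw [← hqe, orient_combo_mid _ _ _ _ _ hst]
  -- If one end is `u`, the other end lies in the same direction from `u` as `q`, hence inside the
  -- angle.
  have hau : a ≠ u := by
    rintro rfl
    refine hno b hab ⟨?_, ?_⟩
    · rw [hfq', orient_self_left] at hfq
      nlinarith
    · have : orient o (a : Plane) a v = 0 := by simp [orient, cross]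
      rw [hgq', this] at hgq
      nlinarith
  have hbu : b ≠ u := by
    rintro rfl
    refine hout ⟨?_, ?_⟩
    · rw [hfq', orient_self_left] at hfq
      nlinarith
    · have : orient o (b : Plane) b v = 0 := by simp [orient, cross]
      rw [hgq', this] at hgq
      nlinarith
  -- The sign tells which ray is left through: positive for the one through `w`, negative for the
  -- one through `v`. Zero would put `u` on the line `ab`.
  rcases lt_trichotomy 0
    (orient o u q v * (- orient o u w a) + orient o u w q * orient o u a v) with hK | hK | hK
  · by_cases hfa : orient o u w a ≤ 0
    · exact false_of_exit hP ho hab hq hl hlu hlw hlq hla hcw huw hv hfq hfa hK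
    · push Not at hfa
      refine hout ⟨hfa, ?_⟩
      by_contra! hga
      nlinarith [mul_pos hgq hfa, mul_nonneg hfq.le (neg_nonneg.2 hga)]
  · have h0 : orient o a b u = 0 := by
      have h1 : orient o u w v * orient o a b u = 0 := by
        have h2 : orient o u w v * orient o a b u =
            orient o u a v * orient o u w b - orient o u w a * orient o u b v := by
          simp only [orient, cross]; ring
        rw [hfq', hgq'] at hK
        rw [h2]
        have h3 : t * (orient o u a v * orient o u w b - orient o u w a * orient o u b v) = 0 := by
          linear_combination -hK
        exact (mul_eq_zero.1 h3).resolve_left ht.ne'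
      exact (mul_eq_zero.1 h1).resolve_left hv.ne'
    exact orient_ne_zero hP ho hab.ne hau hbu h0
  -- Negating `o` and swapping `v` with `w` reflects the situation, which reduces this case to the
  -- first.
  · have e1 : ∀ x y : Plane, orient (-o) u x y = orient o u y x := fun x y => by
      rw [orient_neg, orient_swap o u x y]
    by_cases hga : orient o u a v ≤ 0
    · refine false_of_exit (v := w) (w := v) hP (neg_ne_zero.2 ho) hab hq hl hlu hlv hlq hla hcv
        huv ?_ ?_ ?_ ?_ <;> simp only [e1]
      · exact hv
      · exact hgq
      · exact hga
      · linarith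
    · push Not at hga
      refine hout ⟨?_, hga⟩
      by_contra! hfa
      nlinarith [mul_pos hfq hga, mul_nonneg hgq.le (neg_nonneg.2 hfa)]

end Visibility


/-! ### Coordinates along and across a direction -/

/-- The coordinate of `p` in the direction `φ`. -/
noncomputable def coordY (φ : ℝ) (p : Plane) : ℝ := Real.sin φ * p 0 + Real.cos φ * p 1

/-- The coordinate of `p` perpendicular to the direction `φ`, up to a sign `o`. -/
noncomputable def coordX (o φ : ℝ) (p : Plane) : ℝ := o * (Real.cos φ * p 0 - Real.sin φ * p 1)

theorem inner_dir (φ : ℝ) (p : Plane) : inner ℝ (dir φ) p = coordY φ p := by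
  simp [dir, coordY, PiLp.inner_apply, Fin.sum_univ_two]
  ring

theorem coordY_sub (φ : ℝ) (p q : Plane) : coordY φ (p - q) = coordY φ p - coordY φ q := by
  simp [coordY]; ring

theorem coordX_sub (o φ : ℝ) (p q : Plane) :
    coordX o φ (p - q) = coordX o φ p - coordX o φ q := by
  simp [coordX]; ring

theorem isAffine_coordY (φ : ℝ) : IsAffine (coordY φ) := by
  intro a b s t _
  simp [coordY]; ring

theorem orient_eq_coord (o φ : ℝ) (a b c : Plane) :
    orient o a b c = (coordX o φ b - coordX o φ a) * (coordY φ c - coordY φ a) -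
      (coordY φ b - coordY φ a) * (coordX o φ c - coordX o φ a) := by
  have h := Real.sin_sq_add_cos_sq φ
  simp only [orient, cross, coordX, coordY]
  linear_combination (-o * ((b 0 - a 0) * (c 1 - a 1) - (b 1 - a 1) * (c 0 - a 0))) * h

/-- The direction of the bisector of cone `i`, as an angle. -/
noncomputable def bisectorAngle (m : ℕ) (i : Fin m) : ℝ := ((i : ℕ) : ℝ) * aperture m

theorem inner_bisector (m : ℕ) (i : Fin m) (p : Plane) :
    inner ℝ (bisector m i) p = coordY (bisectorAngle m i) p := inner_dir _ _

theorem half_aperture_pos {m : ℕ} (hm : 3 ≤ m) : 0 < aperture m / 2 := by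
  have : (0 : ℝ) < m := by exact_mod_cast (by omega : 0 < m)
  unfold aperture
  positivity

theorem half_aperture_lt {m : ℕ} (hm : 3 ≤ m) : aperture m / 2 < Real.pi / 2 := by
  have h3 : (3 : ℝ) ≤ m := by exact_mod_cast hm
  have : aperture m ≤ 2 * Real.pi / 3 := by
    unfold aperture
    gcongr
  linarith [Real.pi_pos]

theorem sin_half_aperture_pos {m : ℕ} (hm : 3 ≤ m) : 0 < Real.sin (aperture m / 2) :=
  Real.sin_pos_of_pos_of_lt_pi (half_aperture_pos hm)
    (by linarith [half_aperture_lt hm, Real.pi_pos])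

theorem cos_half_aperture_pos {m : ℕ} (hm : 3 ≤ m) : 0 < Real.cos (aperture m / 2) :=
  Real.cos_pos_of_mem_Ioo ⟨by linarith [half_aperture_pos hm, Real.pi_pos], half_aperture_lt hm⟩

/-- A cone is symmetric about its bisector, so the reflection sign `o` does not affect membership.
-/
theorem mem_cone_iff {m : ℕ} (hm : 3 ≤ m) {o : ℝ} (ho : o * o = 1) (i : Fin m) (u p : Plane) :
    p ∈ cone m i u ↔ |coordX o (bisectorAngle m i) (p - u)| * Real.cos (aperture m / 2) ≤
      Real.sin (aperture m / 2) * coordY (bisectorAngle m i) (p - u) := by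
  have hs := sin_half_aperture_pos hm
  have hc := cos_half_aperture_pos hm
  have habs : |o| = 1 := by
    have := abs_mul_abs_self o
    rw [ho] at this
    nlinarith [abs_nonneg o]
  have hφ := Real.sin_sq_add_cos_sq (bisectorAngle m i)
  rw [show coordX o (bisectorAngle m i) (p - u) = o * coordX 1 (bisectorAngle m i) (p - u) by
    simp [coordX], abs_mul, habs, one_mul]
  set σ := Real.sin (aperture m / 2)
  set κ := Real.cos (aperture m / 2)
  have hL : ∀ j, leftRay m i j = κ * dir (bisectorAngle m i) j -
      σ * (!₂[Real.cos (bisectorAngle m i), -Real.sin (bisectorAngle m i)] : Plane) j := by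
    intro j
    fin_cases j
    · simp [leftRay, dir, bisectorAngle, Real.sin_sub, σ, κ]; ring
    · simp [leftRay, dir, bisectorAngle, Real.cos_sub, σ, κ]; ring
  have hR : ∀ j, rightRay m i j = κ * dir (bisectorAngle m i) j +
      σ * (!₂[Real.cos (bisectorAngle m i), -Real.sin (bisectorAngle m i)] : Plane) j := by
    intro j
    fin_cases j
    · simp [rightRay, dir, bisectorAngle, Real.sin_add, σ, κ]; ring
    · simp [rightRay, dir, bisectorAngle, Real.cos_add, σ, κ]; ring
  set φ := bisectorAngle m i
  constructor
  · rintro ⟨s, t, hs0, ht0, rfl⟩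
    have h1 : coordX 1 φ (u + s • leftRay m i + t • rightRay m i - u) = (t - s) * σ := by
      simp only [coordX, PiLp.sub_apply, PiLp.add_apply, PiLp.smul_apply, smul_eq_mul, hL, hR, dir]
      simp
      linear_combination ((t - s) * σ) * hφ
    have h2 : coordY φ (u + s • leftRay m i + t • rightRay m i - u) = (s + t) * κ := by
      simp only [coordY, PiLp.sub_apply, PiLp.add_apply, PiLp.smul_apply, smul_eq_mul, hL, hR, dir]
      simp
      linear_combination ((s + t) * κ) * hφ
    rw [h1, h2, abs_mul, abs_of_pos hs]
    have : |t - s| ≤ s + t := abs_le.2 ⟨by linarith, by linarith⟩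
    nlinarith [mul_pos hs hc]
  · intro h
    set X := coordX 1 φ (p - u) with hX
    set Y := coordY φ (p - u) with hY
    have h1 : X * κ ≤ σ * Y := (mul_le_mul_of_nonneg_right (le_abs_self X) hc.le).trans h
    have h2 : -X * κ ≤ σ * Y := (mul_le_mul_of_nonneg_right (neg_le_abs X) hc.le).trans h
    refine ⟨(σ * Y - X * κ) / (2 * σ * κ), (σ * Y + X * κ) / (2 * σ * κ),
      div_nonneg (by linarith) (by positivity), div_nonneg (by linarith) (by positivity), ?_⟩
    have e0 : p 0 - u 0 = Real.sin φ * Y + Real.cos φ * X := by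
      simp only [hX, hY, coordX, coordY, PiLp.sub_apply]
      linear_combination (-(p 0 - u 0)) * hφ
    have e1 : p 1 - u 1 = Real.cos φ * Y - Real.sin φ * X := by
      simp only [hX, hY, coordX, coordY, PiLp.sub_apply]
      linear_combination (-(p 1 - u 1)) * hφ
    ext j
    simp only [PiLp.add_apply, PiLp.smul_apply, smul_eq_mul, hL, hR, dir]
    fin_cases j
    · simp
      field_simp
      linear_combination (2 * σ * κ) * e0
    · simp
      field_simp
      linear_combination (2 * σ * κ) * e1

theorem coordY_nonneg_of_mem_cone {m : ℕ} (hm : 3 ≤ m) {i : Fin m} {u p : Plane}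
    (h : p ∈ cone m i u) : coordY (bisectorAngle m i) u ≤ coordY (bisectorAngle m i) p := by
  have := (mem_cone_iff hm (one_mul 1) i u p).1 h
  rw [coordY_sub] at this
  nlinarith [sin_half_aperture_pos hm, cos_half_aperture_pos hm,
    mul_nonneg (abs_nonneg (coordX 1 (bisectorAngle m i) (p - u))) (cos_half_aperture_pos hm).le]

theorem cone_combo {m : ℕ} {i : Fin m} {u p q r : Plane} (hp : p ∈ cone m i u)
    (hq : q ∈ cone m i u) {α β : ℝ} (hα : 0 ≤ α) (hβ : 0 ≤ β)
    (hr : r - u = α • (p - u) + β • (q - u)) : r ∈ cone m i u := by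
  obtain ⟨s, t, hs, ht, rfl⟩ := hp
  obtain ⟨s', t', hs', ht', rfl⟩ := hq
  refine ⟨α * s + β * s', α * t + β * t', by positivity, by positivity, ?_⟩
  rw [sub_eq_iff_eq_add] at hr
  rw [hr]
  module

theorem InAngle.combo {o : ℝ} {u w v p : Plane} (hv : 0 < orient o u w v)
    (hp : InAngle o u w v p) : ∃ α β : ℝ, 0 < α ∧ 0 < β ∧
      p - u = α • (w - u) + β • (v - u) := by
  refine ⟨orient o u p v / orient o u w v, orient o u w p / orient o u w v,
    div_pos hp.2 hv, div_pos hp.1 hv, ?_⟩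
  have hv' := hv.ne'
  ext i
  simp only [PiLp.add_apply, PiLp.sub_apply, PiLp.smul_apply, smul_eq_mul]
  rw [div_mul_eq_mul_div, div_mul_eq_mul_div, ← add_div, eq_div_iff hv']
  fin_cases i <;> simp only [orient, cross, Fin.zero_eta, Fin.mk_one] <;> ring

theorem IsAffine.pos_of_mem_openSegment {l : Plane → ℝ} (hl : IsAffine l) {u p r : Plane} (hu : l u = 0)
    (hp : 0 < l p) (hr : r ∈ openSegment ℝ u p) : 0 < l r := by
  obtain ⟨s, t, hs, ht, hst, rfl⟩ := hr
  rw [hl _ _ _ _ hst, hu]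
  nlinarith

theorem isAffine_orient_mid (o : ℝ) (u v : Plane) : IsAffine fun p => orient o u p v :=
  fun a b _ _ h => orient_combo_mid o u a b v h

theorem coordY_ne {m : ℕ} {P : Finset Plane} (hP : GeneralPosition m P) {a b : P} (hab : a ≠ b)
    (i : Fin m) : coordY (bisectorAngle m i) a ≠ coordY (bisectorAngle m i) b := by
  have := hP.not_perp_bisector b b.2 a a.2 (Subtype.coe_injective.ne hab.symm) i
  rw [inner_bisector, coordY_sub] at this
  exact sub_ne_zero.1 this

/-! ### Closest vertices and the convex chain -/

section Steps

variable {m : ℕ} {P : Finset Plane} {S : SimpleGraph P} {o : ℝ} {u v w : P}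

/-- The next vertex of the convex chain from `v` to `w`, seen from `u`. -/
theorem exists_next (hP : GeneralPosition m P) (hS : PlanarConstraints S) (ho : o ≠ 0) (φ : ℝ)
    (huv : (visibilityGraph S).Adj u v) (huw : (visibilityGraph S).Adj u w)
    (hv : 0 < orient o u w v) (hno : NoConstraintIn S o u w v)
    (hY : coordY φ u < coordY φ v) :
    ∃ v' : P, (v' = w ∨ InAngle o u w v v') ∧ (visibilityGraph S).Adj u v' ∧
      (visibilityGraph S).Adj v v' ∧ 0 < orient o u v' v ∧ 0 ≤ orient o v v' w ∧
      ∀ p : P, InAngle o u w v p → 0 ≤ orient o v v' p := by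
  classical
  rw [visible_iff hS] at huv huw
  obtain ⟨huv, hcv⟩ := huv
  obtain ⟨huw, hcw⟩ := huw
  set C : Finset P := Finset.univ.filter fun p => p = w ∨ InAngle o u w v p with hC
  have hCpos : ∀ p ∈ C, 0 < orient o u p v := by
    intro p hp
    rcases (Finset.mem_filter.1 hp).2 with rfl | h
    · exact hv
    · exact h.2
  -- Gift wrapping: the denominator is proportional to the distance from the line `uv`, so the ratio
  -- orders the directions from `v`, and its minimum leaves every candidate on one side of `vv'`.
  obtain ⟨v', hv'C, hmin⟩ := C.exists_min_image
    (fun p : P => (coordY φ p - coordY φ v) / orient o u p v) ⟨w, by simp [hC]⟩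
  have hpos := hCpos v' hv'C
  have hC' : ∀ p ∈ C, 0 ≤ orient o v v' p := by
    intro p hp
    have h := hmin p hp
    rw [div_le_div_iff₀ hpos (hCpos p hp)] at h
    have hid : orient o v v' p * (coordY φ v - coordY φ u) =
        (coordY φ p - coordY φ v) * orient o u v' v -
        (coordY φ v' - coordY φ v) * orient o u p v := by
      simp only [orient_eq_coord o φ]; ring
    have : 0 ≤ orient o v v' p * (coordY φ v - coordY φ u) := by rw [hid]; linarith
    exact nonneg_of_mul_nonneg_left this (by linarith)
  have hor : v' = w ∨ InAngle o u w v v' := (Finset.mem_filter.1 hv'C).2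
  have hw0 : 0 ≤ orient o v v' w := hC' w (by simp [hC])
  have hang : ∀ p : P, InAngle o u w v p → 0 ≤ orient o v v' p :=
    fun p hp => hC' p (by simp [hC, hp])
  set l : Plane → ℝ := fun p => - orient o v v' p with hl
  have hla : IsAffine l := (isAffine_orient o v v').neg
  have hlu : l u = orient o u v' v := by simp only [hl, orient, cross]; ring
  have hlv : l v = 0 := by simp [hl, orient_self_left]
  have hlv' : l v' = 0 := by simp [hl, orient_self_right]
  have hlw : l w ≤ 0 := by simp only [hl]; linarith
  have hvv' : v ≠ v' := by
    rintro rfl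
    rw [orient_self_right] at hpos
    exact hpos.false
  have huv' : u ≠ v' := by
    rintro rfl
    have : orient o (u : Plane) u v = 0 := by simp [orient, cross]
    rw [this] at hpos
    exact hpos.false
  -- An end strictly on the side of `u` would be a vertex inside the angle, contradicting the choice
  -- of `v'`.
  have hcore : ∀ (a b : P) (q : Plane), S.Adj a b → q ∈ openSegment ℝ (a : Plane) b →
      InAngle o u w v q → 0 ≤ l q → l a ≤ 0 := by
    intro a b q hab hq hqa hlq
    by_contra! hpos'
    have := hang a (inAngle_of_constraint hP ho hab hq hqa hla (by rw [hlu]; exact hpos.le) hlw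
      hlv.le hlq hpos' hcw hcv huw huv hv hno)
    simp only [hl] at hpos'
    linarith
  refine ⟨v', hor, (visible_iff hS).2 ⟨huv', ?_⟩, (visible_iff hS).2 ⟨hvv', ?_⟩, hpos, hw0, hang⟩
  · rcases hor with rfl | hin
    · exact hcw
    · rintro a b hab ⟨r, hr⟩
      obtain ⟨hr1, hr2⟩ : r ∈ openSegment ℝ (u : Plane) v' ∩ openSegment ℝ (a : Plane) b := by
        rw [hr]; rfl
      have hrin : InAngle o u w v r :=
        ⟨IsAffine.pos_of_mem_openSegment (isAffine_orient o u w) (orient_self_left _ _ _) hin.1 hr1,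
          IsAffine.pos_of_mem_openSegment (isAffine_orient_mid o u v) (by simp [orient, cross]) hin.2 hr1⟩
      have hlr : 0 < l r := by
        obtain ⟨s, t, hs, ht, hst, rfl⟩ := hr1
        rw [hla _ _ _ _ hst, hlu, hlv']
        nlinarith
      have h1 := hcore a b r hab hr2 hrin hlr.le
      have h2 := hcore b a r hab.symm (by rwa [openSegment_symm]) hrin hlr.le
      obtain ⟨s, t, hs, ht, hst, rfl⟩ := hr2
      rw [hla _ _ _ _ hst] at hlr
      nlinarith
  · rintro a b hab ⟨r, hr⟩
    obtain ⟨hr1, hr2⟩ : r ∈ openSegment ℝ (v : Plane) v' ∩ openSegment ℝ (a : Plane) b := by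
      rw [hr]; rfl
    have hwv' : 0 ≤ orient o u w v' := by
      rcases hor with rfl | hin
      · rw [orient_self_right]
      · exact hin.1.le
    have hrin : InAngle o u w v r ∧ l r = 0 := by
      obtain ⟨s, t, hs, ht, hst, rfl⟩ := hr1
      refine ⟨⟨?_, ?_⟩, ?_⟩
      · rw [orient_combo _ _ _ _ _ hst]; nlinarith
      · rw [orient_combo_mid _ _ _ _ _ hst, orient_self_right]; nlinarith
      · rw [hla _ _ _ _ hst, hlv, hlv']; ring
    have h1 := hcore a b r hab hr2 hrin.1 hrin.2.ge
    have h2 := hcore b a r hab.symm (by rwa [openSegment_symm]) hrin.1 hrin.2.ge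
    -- Neither end is on the side of `u` and an interior point is on the line `vv'`, so both ends
    -- are on it. General position leaves only the segment `vv'` itself.
    have h3 : l a = 0 ∧ l b = 0 := by
      have h0 := hrin.2
      obtain ⟨s, t, hs, ht, hst, rfl⟩ := hr2
      rw [hla _ _ _ _ hst] at h0
      constructor <;> nlinarith
    have honline : ∀ c : P, l c = 0 → c = v ∨ c = v' := by
      intro c hc
      by_contra! hne
      exact orient_ne_zero hP ho hvv' hne.1.symm hne.2.symm (neg_eq_zero.1 hc)
    have hPI : ProperlyIntersect v v' a b := ⟨r, hr⟩
    have hne := Subtype.coe_injective.ne hvv'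
    rcases honline a h3.1 with rfl | rfl <;> rcases honline b h3.2 with rfl | rfl
    · exact hab.ne rfl
    · exact not_properlyIntersect_self hne hPI
    · unfold ProperlyIntersect at hPI
      rw [openSegment_symm ℝ (a : Plane)] at hPI
      exact not_properlyIntersect_self hne hPI
    · exact hab.ne rfl

/-- A subcone of `u` that contains `w`. -/
theorem exists_subcone_mem (hP : GeneralPosition m P) (i : Fin m) (huw : u ≠ w)
    (hw : (w : Plane) ∈ cone m i u) : ∃ A, IsSubcone m S u i A ∧ (w : Plane) ∈ A := by
  -- `w` may lie on a splitting line, namely when `uw` is a constraint, so a witness is found by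
  -- moving `w` slightly along the right boundary direction. This stays in the cone, leaves the line
  -- `uw` since that is not parallel to the boundary ray, and keeps the side of every other line.
  have hR : ∀ᶠ ε : ℝ in nhdsWithin 0 (Set.Ioi 0), ∀ v : P, v ≠ u →
      cross u v ((w : Plane) + ε • rightRay m i) ≠ 0 ∧
      0 ≤ cross u v ((w : Plane) + ε • rightRay m i) * cross u v w := by
    rw [Filter.eventually_all]
    intro v
    by_cases hvu : v = u
    · simp [hvu]
    by_cases hvw : v = w
    · subst hvw
      filter_upwards [self_mem_nhdsWithin] with ε hε _
      have h0 : cross (u : Plane) v v = 0 := by simp only [cross]; ring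
      refine ⟨?_, by rw [h0, mul_zero]⟩
      have h1 : cross (u : Plane) v ((v : Plane) + ε • rightRay m i) =
          ε * (((v : Plane) 0 - (u : Plane) 0) * rightRay m i 1 -
            ((v : Plane) 1 - (u : Plane) 1) * rightRay m i 0) := by
        simp only [cross, PiLp.add_apply, PiLp.smul_apply, smul_eq_mul]; ring
      rw [h1]
      refine mul_ne_zero (ne_of_gt hε) fun h2 => ?_
      have hu : rightRay m i 0 ^ 2 + rightRay m i 1 ^ 2 = 1 := by
        simp [rightRay, dir]
      refine (hP.not_parallel_ray u u.2 v v.2 (Subtype.coe_injective.ne huw) i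
        (((v : Plane) 0 - (u : Plane) 0) * rightRay m i 0 +
          ((v : Plane) 1 - (u : Plane) 1) * rightRay m i 1)).2 ?_
      ext j
      fin_cases j
      · simp only [PiLp.sub_apply, PiLp.smul_apply, smul_eq_mul, Fin.zero_eta]
        linear_combination rightRay m i 1 * h2 - ((v : Plane) 0 - (u : Plane) 0) * hu
      · simp only [PiLp.sub_apply, PiLp.smul_apply, smul_eq_mul, Fin.mk_one]
        linear_combination -rightRay m i 0 * h2 - ((v : Plane) 1 - (u : Plane) 1) * hu
    · have hne := cross_ne_zero hP u.2 v.2 w.2 (Subtype.coe_injective.ne (Ne.symm hvu))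
        (Subtype.coe_injective.ne huw) (Subtype.coe_injective.ne hvw)
      have hcont : Continuous fun ε : ℝ =>
          cross u v ((w : Plane) + ε • rightRay m i) * cross u v w := by
        simp only [cross, PiLp.add_apply, PiLp.smul_apply, smul_eq_mul]
        fun_prop
      have h0 : 0 < cross u v ((w : Plane) + (0 : ℝ) • rightRay m i) * cross u v w := by
        rw [zero_smul, add_zero]
        exact mul_self_pos.2 hne
      filter_upwards [nhdsWithin_le_nhds (hcont.continuousAt.eventually (lt_mem_nhds h0))]
        with ε hε _
      exact ⟨fun h => by rw [h, zero_mul] at hε; exact hε.false, le_of_lt hε⟩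
  obtain ⟨ε, hε, hε0⟩ := (hR.and self_mem_nhdsWithin).exists
  have hε0 : 0 < ε := hε0
  refine ⟨_, ⟨(w : Plane) + ε • rightRay m i, ?_, fun v hv _ => (hε v hv.ne').1, rfl⟩, hw,
    fun v hv _ => (hε v hv.ne').2⟩
  obtain ⟨s, t, hs, ht, hst⟩ := hw
  exact ⟨s, t + ε, hs, by positivity, by rw [hst]; module⟩

theorem dist_bisectorProj (i : Fin m) (u p : Plane) :
    dist u (bisectorProj m i u p) = |coordY (bisectorAngle m i) (p - u)| := by
  have h : ‖bisector m i‖ = 1 := by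
    rw [bisector, norm_eq_sqrt_real_inner, inner_dir_dir]; simp
  rw [bisectorProj, dist_self_add_right, norm_smul, h, mul_one, inner_bisector, Real.norm_eq_abs]

/-- The closest visible vertex in a subcone that contains `w`. -/
theorem exists_closest (hm : 3 ≤ m) (hP : GeneralPosition m P) (hS : PlanarConstraints S)
    (i : Fin m) (huw : (visibilityGraph S).Adj u w) (hw : (w : Plane) ∈ cone m i u) :
    ∃ v : P, AddsEdge m S u v ∧ (visibilityGraph S).Adj u v ∧ (v : Plane) ∈ cone m i u ∧
      coordY (bisectorAngle m i) v ≤ coordY (bisectorAngle m i) w ∧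
      ∀ o : ℝ, o ≠ 0 → 0 < orient o u w v → NoConstraintIn S o u w v ∧
        ∀ p : P, InAngle o u w v p →
          coordY (bisectorAngle m i) v ≤ coordY (bisectorAngle m i) p := by
  classical
  obtain ⟨A, hA, hwA⟩ := exists_subcone_mem (S := S) hP i huw.ne hw
  obtain ⟨v, hv, hmin⟩ := (Finset.univ.filter fun p : P => (p : Plane) ∈ A ∧
    (visibilityGraph S).Adj u p).exists_min_image (fun p : P => dist (u : Plane)
      (bisectorProj m i u p)) ⟨w, by simp [hwA, huw]⟩
  obtain ⟨-, hvA, huv⟩ := Finset.mem_filter.1 hv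
  have hmin' : ∀ p : P, (p : Plane) ∈ A → (visibilityGraph S).Adj u p →
      dist (u : Plane) (bisectorProj m i u v) ≤ dist (u : Plane) (bisectorProj m i u p) :=
    fun p hp hup => hmin p (by simp [hp, hup])
  have hAcone : ∀ p ∈ A, p ∈ cone m i u := by
    obtain ⟨q, -, -, rfl⟩ := hA
    exact fun p hp => hp.1
  have hle : ∀ p : P, (p : Plane) ∈ A → (visibilityGraph S).Adj u p →
      coordY (bisectorAngle m i) v ≤ coordY (bisectorAngle m i) p := by
    intro p hp hup
    have h := hmin' p hp hup
    have h1 := coordY_nonneg_of_mem_cone hm (hAcone _ hp)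
    have h2 := coordY_nonneg_of_mem_cone hm (hAcone _ hvA)
    rw [dist_bisectorProj, dist_bisectorProj, coordY_sub, coordY_sub,
      abs_of_nonneg (by linarith), abs_of_nonneg (by linarith)] at h
    linarith
  refine ⟨v, ⟨i, A, hA, hvA, huv, hmin'⟩, huv, hAcone _ hvA, hle w hwA huw, fun o ho hor => ?_⟩
  have hcone : ∀ p : Plane, InAngle o u w v p → p ∈ cone m i u := by
    intro p hp
    obtain ⟨α, β, hα, hβ, h⟩ := hp.combo hor
    exact cone_combo hw (hAcone _ hvA) hα.le hβ.le h
  have hinA : ∀ p : Plane, InAngle o u w v p → p ∈ A := by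
    intro p hp
    have hpc := hcone p hp
    obtain ⟨α, β, hα, hβ, h⟩ := hp.combo hor
    obtain ⟨q, hq, hq', rfl⟩ := hA
    refine ⟨hpc, fun b hb hbc => ?_⟩
    have e : cross u b p = α * cross u b w + β * cross u b v := by
      have h0 := congrArg (fun x : Plane => x 0) h
      have h1 := congrArg (fun x : Plane => x 1) h
      simp only [PiLp.add_apply, PiLp.sub_apply, PiLp.smul_apply, smul_eq_mul] at h0 h1
      simp only [cross, h0, h1]; ring
    rw [e]
    have i1 := mul_nonneg hα.le (hwA.2 b hb hbc)
    have i2 := mul_nonneg hβ.le (hvA.2 b hb hbc)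
    linarith
  -- The line through such a constraint would strictly separate `w` from `v`, which lie in the same
  -- subcone.
  have hno : NoConstraintIn S o u w v := by
    intro b hb hin
    have hbc := hcone b hin
    obtain ⟨q, hq, hq', rfl⟩ := hA
    have hne := hq' b hb hbc
    have i1 := hwA.2 b hb hbc
    have i2 := hvA.2 b hb hbc
    have h1 : o * cross u b w < 0 := by
      have := hin.1; rw [orient_swap] at this; simpa [orient] using this
    have h2 : 0 < o * cross u b v := hin.2
    rcases lt_or_gt_of_ne hne with hneg | hpos
    · have j1 : cross u b w ≤ 0 := by nlinarith
      have j2 : cross u b v ≤ 0 := by nlinarith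
      rcases lt_or_gt_of_ne ho with ho' | ho' <;> nlinarith
    · have j1 : 0 ≤ cross u b w := by nlinarith
      have j2 : 0 ≤ cross u b v := by nlinarith
      rcases lt_or_gt_of_ne ho with ho' | ho' <;> nlinarith
  refine ⟨hno, ?_⟩
  -- Minimality of `v` covers only visible vertices. However, the lowest vertex `x` of the angle is
  -- visible: a constraint crossing `ux` would have an end inside the angle and below `x`.
  by_contra! hlow
  obtain ⟨p, hp, hpY⟩ := hlow
  obtain ⟨x, hx, hxmin⟩ := (Finset.univ.filter fun p : P => InAngle o u w v p).exists_min_image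
    (fun p : P => coordY (bisectorAngle m i) p) ⟨p, by simp [hp]⟩
  have hxin : InAngle o u w v x := (Finset.mem_filter.1 hx).2
  have hxmin' : ∀ p : P, InAngle o u w v p →
      coordY (bisectorAngle m i) x ≤ coordY (bisectorAngle m i) p :=
    fun p hp => hxmin p (by simp [hp])
  have hxv := (hxmin' p hp).trans_lt hpY
  have hux : u ≠ x := by
    rintro rfl
    exact absurd hxin.1 (by rw [orient_self_left]; exact lt_irrefl 0)
  set l : Plane → ℝ := fun p =>
    coordY (bisectorAngle m i) x - coordY (bisectorAngle m i) p with hl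
  have hla : IsAffine l := by
    intro a b s t hst
    simp only [hl, isAffine_coordY _ a b s t hst]
    linear_combination (-coordY (bisectorAngle m i) (x : Plane)) * hst
  have hlu : 0 < l u := by
    have h1 := coordY_nonneg_of_mem_cone hm (hcone _ hxin)
    have h2 := coordY_ne hP hux i
    simp only [hl]
    exact sub_pos.2 (lt_of_le_of_ne h1 h2)
  refine absurd (hle x (hinA x hxin) ((visible_iff hS).2 ⟨hux, ?_⟩)) (not_le.2 hxv)
  rintro a b hab ⟨r, hr⟩
  obtain ⟨hr1, hr2⟩ : r ∈ openSegment ℝ (u : Plane) x ∩ openSegment ℝ (a : Plane) b := by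
    rw [hr]; rfl
  have hrin : InAngle o u w v r :=
    ⟨IsAffine.pos_of_mem_openSegment (isAffine_orient o u w) (orient_self_left _ _ _) hxin.1 hr1,
      IsAffine.pos_of_mem_openSegment (isAffine_orient_mid o u v) (by simp [orient, cross]) hxin.2 hr1⟩
  have hlr : 0 < l r := by
    obtain ⟨s, t, hs, ht, hst, rfl⟩ := hr1
    have : l x = 0 := sub_self _
    rw [hla _ _ _ _ hst, this]
    nlinarith
  have hvw := hle w hwA huw
  have hcore : ∀ a b : P, S.Adj a b → r ∈ openSegment ℝ (a : Plane) b → l a ≤ 0 := by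
    intro a b hab hrab
    by_contra! hpos
    have := hxmin' a (inAngle_of_constraint hP ho hab hrab hrin hla hlu.le
      (by simp only [hl]; linarith) (by simp only [hl]; linarith) hlr.le hpos
      ((visible_iff hS).1 huw).2 ((visible_iff hS).1 huv).2 huw.ne huv.ne hor hno)
    simp only [hl] at hpos
    linarith
  have h1 := hcore a b hab hr2
  have h2 := hcore b a hab.symm (by rwa [openSegment_symm])
  obtain ⟨s, t, hs, ht, hst, rfl⟩ := hr2
  rw [hla _ _ _ _ hst] at hlr
  nlinarith

end Steps


/-! ### The length bound in terms of the canonical triangle -/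

/-- The factor `c` of the length bound. -/
noncomputable def stretch (θ : ℝ) : ℝ :=
  Real.cos (θ / 4) / (Real.cos (θ / 2) - Real.sin (3 * θ / 4))

/-- The length bound for a displacement of height `y` and width `x` in a canonical triangle. -/
noncomputable def lengthBound (θ y x : ℝ) : ℝ :=
  y / Real.cos (θ / 2) + stretch θ * (y * Real.tan (θ / 2) + x)

section Trigonometry

variable {k : ℕ}

theorem mul_aperture (m : ℕ) (hm : m ≠ 0) : (m : ℝ) * aperture m = 2 * Real.pi := by
  have : (m : ℝ) ≠ 0 := by exact_mod_cast hm
  unfold aperture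
  field_simp

theorem aperture_mul_four (k : ℕ) :
    (4 * (k : ℝ) + 3) * aperture (4 * k + 3) = 2 * Real.pi := by
  have := mul_aperture (4 * k + 3) (by omega)
  push_cast at this
  exact this

theorem aperture_le (hk : 1 ≤ k) : 7 * aperture (4 * k + 3) ≤ 2 * Real.pi := by
  have h := aperture_mul_four k
  have h0 := half_aperture_pos (m := 4 * k + 3) (by omega)
  have hk' : (1 : ℝ) ≤ k := by exact_mod_cast hk
  nlinarith

/-- Sum-to-product formulas turn c into sin(π/4 + θ/8) / cos(π/4 + 5θ/8), the form in which
`trig_bound` uses it. -/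
theorem stretch_spec {θ : ℝ} (h0 : 0 < θ) (h7 : 7 * θ ≤ 2 * Real.pi) :
    0 < Real.cos (Real.pi / 4 + 5 * θ / 8) ∧
      stretch θ * Real.cos (Real.pi / 4 + 5 * θ / 8) = Real.sin (Real.pi / 4 + θ / 8) ∧
      0 < stretch θ := by
  have hp := Real.pi_pos
  have c1 : 0 < Real.cos (Real.pi / 4 + θ / 8) :=
    Real.cos_pos_of_mem_Ioo ⟨by linarith, by linarith⟩
  have c2 : 0 < Real.cos (Real.pi / 4 + 5 * θ / 8) :=
    Real.cos_pos_of_mem_Ioo ⟨by linarith, by linarith⟩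
  have s1 : 0 < Real.sin (Real.pi / 4 + θ / 8) :=
    Real.sin_pos_of_pos_of_lt_pi (by linarith) (by linarith)
  have e1 : Real.cos (θ / 4) = 2 * Real.sin (Real.pi / 4 + θ / 8) *
      Real.cos (Real.pi / 4 + θ / 8) := by
    rw [← Real.sin_two_mul, ← Real.sin_add_pi_div_two]
    congr 1; ring
  have e2 : Real.cos (θ / 2) - Real.sin (3 * θ / 4) = 2 * Real.cos (Real.pi / 4 + 5 * θ / 8) *
      Real.cos (Real.pi / 4 + θ / 8) := by
    have a1 : Real.cos (θ / 2) = Real.cos ((Real.pi / 4 + 5 * θ / 8) - (Real.pi / 4 + θ / 8)) := by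
      congr 1; ring
    have a2 : - Real.sin (3 * θ / 4) =
        Real.cos ((Real.pi / 4 + 5 * θ / 8) + (Real.pi / 4 + θ / 8)) := by
      rw [← Real.cos_add_pi_div_two]; congr 1; ring
    rw [sub_eq_add_neg, a1, a2, Real.cos_sub (Real.pi / 4 + 5 * θ / 8),
      Real.cos_add (Real.pi / 4 + 5 * θ / 8) (Real.pi / 4 + θ / 8)]
    ring
  have e3 : stretch θ = Real.sin (Real.pi / 4 + θ / 8) / Real.cos (Real.pi / 4 + 5 * θ / 8) := by
    rw [stretch, e1, e2, mul_div_mul_right _ _ c1.ne', mul_div_mul_left _ _ two_ne_zero]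
  refine ⟨c2, ?_, ?_⟩
  · rw [e3, div_mul_cancel₀ _ c2.ne']
  · rw [e3]; exact div_pos s1 c2

/-- A direction at angle `φ` from one bisector and at angle `a` from another one has the smaller
bound with respect to the latter. -/
theorem trig_bound {θ a φ : ℝ} (h0 : 0 < θ) (h7 : 7 * θ ≤ 2 * Real.pi) (ha : 0 ≤ a)
    (haφ : a ≤ φ) (hsum : φ + a ≤ Real.pi / 2 + θ / 4) :
    Real.cos a + stretch θ * Real.sin (a + θ / 2) ≤
      Real.cos φ + stretch θ * Real.sin (φ + θ / 2) := by
  obtain ⟨-, hc, hpos⟩ := stretch_spec h0 h7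
  have hp := Real.pi_pos
  set β := (φ + a) / 2 with hβ
  set δ := (φ - a) / 2 with hδ
  have e1 : Real.cos a - Real.cos φ = 2 * Real.sin β * Real.sin δ := by
    rw [show a = β - δ by rw [hβ, hδ]; ring, show φ = β + δ by rw [hβ, hδ]; ring,
      Real.cos_sub, Real.cos_add]
    ring
  have e2 : Real.sin (φ + θ / 2) - Real.sin (a + θ / 2) =
      2 * Real.cos (β + θ / 2) * Real.sin δ := by
    rw [show a + θ / 2 = (β + θ / 2) - δ by rw [hβ, hδ]; ring,
      show φ + θ / 2 = (β + θ / 2) + δ by rw [hβ, hδ]; ring,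
      Real.sin_sub, Real.sin_add]
    ring
  have hsδ : 0 ≤ Real.sin δ :=
    Real.sin_nonneg_of_nonneg_of_le_pi (by linarith) (by linarith)
  -- After division by 2 sin δ the claim is sin β ≤ c cos(β + θ/2). Its worst case is β = π/4 + θ/8,
  -- where the value of c gives equality.
  have h1 : Real.sin β ≤ Real.sin (Real.pi / 4 + θ / 8) :=
    Real.sin_le_sin_of_le_of_le_pi_div_two (by linarith) (by linarith) (by linarith)
  have h2 : Real.cos (Real.pi / 4 + 5 * θ / 8) ≤ Real.cos (β + θ / 2) :=
    Real.cos_le_cos_of_nonneg_of_le_pi (by linarith) (by linarith) (by linarith)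
  have h3 : Real.sin β ≤ stretch θ * Real.cos (β + θ / 2) :=
    h1.trans (hc ▸ mul_le_mul_of_nonneg_left h2 hpos.le)
  have h4 := mul_le_mul_of_nonneg_right h3 hsδ
  nlinarith

theorem two_mul_sin_lt {θ : ℝ} (h0 : 0 < θ) (h7 : 7 * θ ≤ 2 * Real.pi) :
    2 * Real.sin (θ / 2) < Real.cos (θ / 2) := by
  have h1 : Real.sin (θ / 2) ≤ θ / 2 := Real.sin_le (by linarith)
  have h2 := Real.one_sub_sq_div_two_le_cos (x := θ / 2)
  -- At θ = 2π/7 these estimates leave a margin below 0.002; the bound π < 3.15 would not suffice.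
  have h3 := Real.pi_lt_d4
  nlinarith

/-- After multiplication by `C` and insertion of the bound on `x`, the left side is affine in `y`,
so only the ends matter: `y = 0` is handled by `2 * S < C`, and `y = H` by `hc`. -/
theorem combo_lt {s c x y H S C : ℝ} (hs0 : 0 ≤ s) (hs1 : s ≤ 1) (hS : 0 ≤ S) (hC : 0 < C)
    (hSC : 2 * S < C) (hc : c * C + s * S ≤ C) (hy : 0 < y) (hyH : y < H)
    (hx : x * C ≤ S * (2 * H - y)) : c * y + s * x < H := by
  have hH : 0 < H := hy.trans hyH
  refine lt_of_mul_lt_mul_right ?_ hC.le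
  have a1 := mul_le_mul_of_nonneg_left hx hs0
  rcases le_or_gt (c * C - s * S) 0 with hneg | hpos
  · have a2 := mul_nonneg (neg_nonneg.2 hneg) hy.le
    have a3 : s * S ≤ S := by nlinarith
    have a4 : H * (2 * (s * S)) < H * C := mul_lt_mul_of_pos_left (by linarith) hH
    nlinarith
  · have a2 := mul_lt_mul_of_pos_left hyH hpos
    have a3 := mul_le_mul_of_nonneg_left hc hH.le
    nlinarith

/-- Lets cone indices be shifted by any integer: reduction modulo `m` changes the angle by full
turns. -/
theorem exists_bisectorAngle {m : ℕ} (hm : m ≠ 0) (N : ℤ) :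
    ∃ (j : Fin m) (M : ℤ), bisectorAngle m j = N * aperture m + M * (2 * Real.pi) := by
  have hm' : (m : ℤ) ≠ 0 := by exact_mod_cast hm
  have h0 := Int.emod_nonneg N hm'
  have h1 := Int.emod_lt_of_pos N (by omega : (0 : ℤ) < m)
  refine ⟨⟨(N % m).toNat, by omega⟩, -(N / m), ?_⟩
  have h2 : (((N % m).toNat : ℕ) : ℝ) = N - m * (N / m : ℤ) := by
    have h3 : (((N % m).toNat : ℕ) : ℤ) = N - m * (N / m) := by
      rw [Int.toNat_of_nonneg h0, Int.emod_def]
    exact_mod_cast h3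
  rw [bisectorAngle]
  simp only [h2]
  push_cast
  linear_combination (-((N / m : ℤ) : ℝ)) * mul_aperture m hm

theorem coordY_add (φ η : ℝ) (d : Plane) :
    coordY (φ + η) d = Real.cos η * coordY φ d + Real.sin η * coordX 1 φ d := by
  simp only [coordY, coordX, Real.sin_add, Real.cos_add]; ring

theorem coordX_add (φ η : ℝ) (d : Plane) :
    coordX 1 (φ + η) d = Real.cos η * coordX 1 φ d - Real.sin η * coordY φ d := by
  simp only [coordY, coordX, Real.sin_add, Real.cos_add]; ring

/-- A displacement that points upwards and sideways with respect to cone `i` lies in some cone `j`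
whose bound does not exceed the one of cone `i`. -/
theorem exists_cone_bound (hk : 1 ≤ k) (i : Fin (4 * k + 3)) {o : ℝ} (ho : o = 1 ∨ o = -1)
    {v v' : Plane} (hX : 0 ≤ coordX o (bisectorAngle _ i) (v' - v))
    (hY : 0 < coordY (bisectorAngle _ i) (v' - v)) :
    ∃ j : Fin (4 * k + 3), v' ∈ cone (4 * k + 3) j v ∧
      lengthBound (aperture (4 * k + 3)) (coordY (bisectorAngle _ j) (v' - v))
        |coordX 1 (bisectorAngle _ j) (v' - v)| ≤
      lengthBound (aperture (4 * k + 3)) (coordY (bisectorAngle _ i) (v' - v))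
        (coordX o (bisectorAngle _ i) (v' - v)) ∧
      ∀ H : ℝ, coordY (bisectorAngle _ i) (v' - v) < H →
        coordX o (bisectorAngle _ i) (v' - v) * Real.cos (aperture (4 * k + 3) / 2) ≤
          Real.sin (aperture (4 * k + 3) / 2) *
            (2 * H - coordY (bisectorAngle _ i) (v' - v)) →
        coordY (bisectorAngle _ j) (v' - v) < H := by
  have hm : 3 ≤ 4 * k + 3 := by omega
  have hS := sin_half_aperture_pos hm
  have hC := cos_half_aperture_pos hm
  have h0 : 0 < aperture (4 * k + 3) := by linarith [half_aperture_pos hm]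
  have h7 := aperture_le hk
  have h4 := aperture_mul_four k
  have hst := two_mul_sin_lt h0 h7
  have hp := Real.pi_pos
  have hoo : o * o = 1 := by rcases ho with rfl | rfl <;> norm_num
  set θ := aperture (4 * k + 3) with hθ
  set d := v' - v with hd
  set X := coordX o (bisectorAngle _ i) d with hXd
  set Y := coordY (bisectorAngle _ i) d with hYd
  set φ := Real.arctan (X / Y) with hφ
  have hφ0 : 0 ≤ φ := Real.arctan_nonneg.2 (div_nonneg hX hY.le)
  have hφ1 : φ < Real.pi / 2 := Real.arctan_lt_pi_div_two _
  have hcφ : 0 < Real.cos φ := Real.cos_arctan_pos _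
  set r := Y / Real.cos φ with hr
  have hr0 : 0 < r := div_pos hY hcφ
  have hYr : Y = r * Real.cos φ := (div_mul_cancel₀ _ hcφ.ne').symm
  have hXr : X = r * Real.sin φ := by
    have : Real.tan φ = X / Y := Real.tan_arctan _
    rw [Real.tan_eq_sin_div_cos, div_eq_div_iff hcφ.ne' hY.ne'] at this
    rw [hr, div_mul_eq_mul_div, eq_div_iff hcφ.ne']
    linarith
  -- Rounding φ/θ to the nearest integer gives the number of cones to turn, leaving a deviation ψ of
  -- at most θ/2 from the new bisector.
  set n := ⌊φ / θ + 1 / 2⌋₊ with hn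
  have hn1 : (n : ℝ) * θ ≤ φ + θ / 2 := by
    have := Nat.floor_le (show 0 ≤ φ / θ + 1 / 2 by positivity)
    rw [← hn] at this
    calc (n : ℝ) * θ ≤ (φ / θ + 1 / 2) * θ := by gcongr
      _ = φ + θ / 2 := by field_simp
  have hn2 : φ - θ / 2 < n * θ := by
    have := Nat.lt_floor_add_one (φ / θ + 1 / 2)
    rw [← hn] at this
    have h : (φ / θ + 1 / 2) * θ < (n + 1) * θ := by gcongr
    have h' : (φ / θ + 1 / 2) * θ = φ + θ / 2 := by field_simp
    linarith
  have hnk : n ≤ k + 1 := by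
    have h : (n : ℝ) * θ < ((k + 2 : ℕ) : ℝ) * θ := by push_cast; nlinarith
    have h' : (n : ℝ) < ((k + 2 : ℕ) : ℝ) := lt_of_mul_lt_mul_right h h0.le
    have : n < k + 2 := by exact_mod_cast h'
    omega
  have hnk' : (n : ℝ) * θ ≤ (k + 1) * θ := by
    have : (n : ℝ) ≤ k + 1 := by exact_mod_cast hnk
    gcongr
  set ψ := φ - n * θ with hψ
  have hψa : |ψ| ≤ θ / 2 := abs_le.2 ⟨by linarith, by linarith⟩
  obtain ⟨z, hz⟩ : ∃ z : ℤ, (z : ℝ) = o := by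
    rcases ho with rfl | rfl
    · exact ⟨1, by simp⟩
    · exact ⟨-1, by simp⟩
  obtain ⟨j, M, hj⟩ := exists_bisectorAngle (m := 4 * k + 3) (by omega) ((i : ℕ) + z * n)
  have hj' : bisectorAngle _ j = bisectorAngle _ i + (o * (n * θ) + M * (2 * Real.pi)) := by
    rw [hj, bisectorAngle, ← hz]; push_cast; ring
  have hcos : Real.cos (o * (n * θ) + M * (2 * Real.pi)) = Real.cos (n * θ) := by
    rw [Real.cos_add_int_mul_two_pi]
    rcases ho with rfl | rfl
    · rw [one_mul]
    · rw [neg_one_mul, Real.cos_neg]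
  have hsin : Real.sin (o * (n * θ) + M * (2 * Real.pi)) = o * Real.sin (n * θ) := by
    rw [Real.sin_add_int_mul_two_pi]
    rcases ho with rfl | rfl
    · rw [one_mul, one_mul]
    · rw [neg_one_mul, neg_one_mul, Real.sin_neg]
  have hX1 : coordX 1 (bisectorAngle _ i) d = o * X := by
    simp only [hXd, coordX]
    linear_combination (-(Real.cos (bisectorAngle _ i) * d 0 - Real.sin (bisectorAngle _ i) * d 1))
      * hoo
  have hYj' : coordY (bisectorAngle _ j) d = Real.cos (n * θ) * Y + Real.sin (n * θ) * X := by
    rw [hj', coordY_add, hcos, hsin, hX1, ← hYd]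
    linear_combination (Real.sin (n * θ) * X) * hoo
  have hYj : coordY (bisectorAngle _ j) d = r * Real.cos |ψ| := by
    rw [hYj', Real.cos_abs, hψ, Real.cos_sub, hXr, hYr]; ring
  have hXj : |coordX 1 (bisectorAngle _ j) d| = r * Real.sin |ψ| := by
    have h1 : coordX 1 (bisectorAngle _ j) d = o * (r * Real.sin ψ) := by
      rw [hj', coordX_add, hcos, hsin, hX1, ← hYd, hψ, Real.sin_sub, hXr, hYr]; ring
    have h2 : |o| = 1 := by rcases ho with rfl | rfl <;> simp
    rw [h1, abs_mul, h2, one_mul, abs_mul, abs_of_pos hr0,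
      Real.abs_sin_eq_sin_abs_of_abs_le_pi (by linarith)]
  refine ⟨j, ?_, ?_, ?_⟩
  · rw [mem_cone_iff hm (one_mul 1), ← hd, hXj, hYj, ← hθ]
    have h : 0 ≤ Real.sin (θ / 2 - |ψ|) :=
      Real.sin_nonneg_of_nonneg_of_le_pi (by linarith) (by linarith [abs_nonneg ψ])
    rw [Real.sin_sub] at h
    nlinarith
  -- For n = k+1 the direction lies before the bisector, and φ + |ψ| is exactly (k+1)θ = π/2 + θ/4.
  -- For n ≤ k, φ ≤ kθ + θ/2 = π/2 - θ/4 and |ψ| ≤ θ/2.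
  · have hsum : φ + |ψ| ≤ Real.pi / 2 + θ / 4 := by
      rcases Nat.lt_or_ge k n with h | h
      · have hnk'' : (n : ℝ) = k + 1 := by exact_mod_cast (by omega : n = k + 1)
        have hψ0 : ψ ≤ 0 := by
          rw [hψ, hnk'']; linarith
        rw [abs_of_nonpos hψ0, hψ, hnk'']
        linarith
      · have h' : (n : ℝ) * θ ≤ k * θ := by
          have : (n : ℝ) ≤ k := by exact_mod_cast h
          gcongr
        linarith
    have hle : |ψ| ≤ φ := by
      rcases Nat.eq_zero_or_pos n with h | h
      · rw [hψ, h]; simp [abs_of_nonneg hφ0]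
      · have h' : (1 : ℝ) * θ ≤ n * θ := by
          have : (1 : ℝ) ≤ n := by exact_mod_cast h
          gcongr
        linarith
    have key := trig_bound h0 h7 (abs_nonneg ψ) hle hsum
    rw [hXj, hYj, hXr, hYr]
    have hform : ∀ x : ℝ, lengthBound θ (r * Real.cos x) (r * Real.sin x) =
        r / Real.cos (θ / 2) * (Real.cos x + stretch θ * Real.sin (x + θ / 2)) := by
      intro x
      rw [lengthBound, Real.tan_eq_sin_div_cos, Real.sin_add]
      field_simp
      ring
    rw [hform, hform]
    exact mul_le_mul_of_nonneg_left key (by positivity)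
  · intro H hH hXH
    rw [hYj']
    rcases Nat.eq_zero_or_pos n with h | h
    · rw [h]; simpa using hH
    · have h' : (1 : ℝ) * θ ≤ n * θ := by
        have : (1 : ℝ) ≤ n := by exact_mod_cast h
        gcongr
      have hs0 : 0 ≤ Real.sin (n * θ) :=
        Real.sin_nonneg_of_nonneg_of_le_pi (by positivity) (by linarith)
      have hs1 : Real.sin (n * θ) ≤ 1 := Real.sin_le_one _
      -- This says that turning by nθ does not raise the height of the right corner of the triangle.
      have hc : Real.cos (n * θ - θ / 2) ≤ Real.cos (θ / 2) :=
        Real.cos_le_cos_of_nonneg_of_le_pi (by linarith) (by linarith) (by linarith)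
      rw [Real.cos_sub] at hc
      exact combo_lt hs0 hs1 hS.le hC hst (by linarith) hY hH hXH

end Trigonometry


/-! ### Walks of bounded length -/

section Walks

variable {P : Finset Plane} {G : SimpleGraph P}

/-- There is a walk from `x` to `y` of length at most `ℓ`. -/
def Reach (G : SimpleGraph P) (x y : P) (ℓ : ℝ) : Prop := ∃ p : G.Walk x y, walkLength p ≤ ℓ

theorem Reach.trans {x y z : P} {ℓ ℓ' : ℝ} (h : Reach G x y ℓ) (h' : Reach G y z ℓ') :
    Reach G x z (ℓ + ℓ') := by
  obtain ⟨p, hp⟩ := h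
  obtain ⟨q, hq⟩ := h'
  refine ⟨p.append q, ?_⟩
  have : walkLength (p.append q) = walkLength p + walkLength q := by
    simp [walkLength]
  linarith

theorem Reach.mono {x y : P} {ℓ ℓ' : ℝ} (h : Reach G x y ℓ) (hℓ : ℓ ≤ ℓ') : Reach G x y ℓ' :=
  h.imp fun _ hp => hp.trans hℓ

theorem Reach.of_adj {x y : P} (h : G.Adj x y) : Reach G x y (dist (x : Plane) y) :=
  ⟨h.toWalk, by simp [walkLength]⟩

theorem Reach.exists_isPath {x y : P} {ℓ : ℝ} (h : Reach G x y ℓ) :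
    ∃ p : G.Walk x y, p.IsPath ∧ walkLength p ≤ ℓ := by
  classical
  obtain ⟨p, hp⟩ := h
  refine ⟨p.bypass, p.bypass_isPath, le_trans ?_ hp⟩
  refine (p.darts_bypass_sublist_darts.map _).sum_le_sum fun a ha => ?_
  obtain ⟨d, -, rfl⟩ := List.mem_map.1 ha
  exact dist_nonneg

end Walks

theorem lengthBound_add (θ y x y' x' : ℝ) :
    lengthBound θ y x + lengthBound θ y' x' = lengthBound θ (y + y') (x + x') := by
  simp only [lengthBound]; ring

theorem lengthBound_mono {θ y x x' : ℝ} (h0 : 0 < θ) (h7 : 7 * θ ≤ 2 * Real.pi) (h : x ≤ x') :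
    lengthBound θ y x ≤ lengthBound θ y x' := by
  have := (stretch_spec h0 h7).2.2
  unfold lengthBound
  gcongr

theorem abs_coordX {o : ℝ} (ho : o = 1 ∨ o = -1) (φ : ℝ) (d : Plane) :
    |coordX 1 φ d| = |coordX o φ d| := by
  rcases ho with rfl | rfl
  · rfl
  · simp [coordX, abs_sub_comm]

/-- The slope bound for the next vertex of the chain. -/
theorem mul_sub_le {S C x y x' y' : ℝ} (hC : 0 < C) (hy : 0 < y) (hyy : y ≤ y')
    (h : -x * C ≤ S * y) (hor : 0 < x' * y - y' * x) : (x - x') * C ≤ S * (y' - y) := by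
  have h1 : 0 ≤ S * y + x * C := by linarith
  -- S·y + C·x measures the distance from the left boundary line. Turning right and climbing cannot
  -- decrease it.
  have h2 : (S * y + x * C) * y' ≤ (S * y' + x' * C) * y := by
    nlinarith [mul_pos hC hor]
  have h3 : (S * y + x * C) * y ≤ (S * y' + x' * C) * y :=
    (mul_le_mul_of_nonneg_left hyy h1).trans h2
  have := le_of_mul_le_mul_right h3 hy
  linarith

/-! ### Induction along the chain and over canonical triangles -/

section Chain

variable {k : ℕ} {P : Finset Plane} {S : SimpleGraph P}

/-- Induction up the chain, with `v` its current vertex. The first alternative of `hreach` is the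
rightward phase, whose bound has signed width. The second is the leftward phase, with the opposite
sign and all remaining vertices to the left of `v`, so that the chain never turns right again. -/
theorem reach_of_chain (hk : 1 ≤ k) (hP : GeneralPosition (4 * k + 3) P)
    (hS : PlanarConstraints S) (i : Fin (4 * k + 3)) {o : ℝ} (ho : o = 1 ∨ o = -1) {u w : P}
    (huw : (visibilityGraph S).Adj u w) (hw : (w : Plane) ∈ cone (4 * k + 3) i u)
    (IH : ∀ x y : P, (visibilityGraph S).Adj x y → ∀ j, (y : Plane) ∈ cone (4 * k + 3) j x →
      coordY (bisectorAngle _ j) ((y : Plane) - x) < coordY (bisectorAngle _ i) ((w : Plane) - u) →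
      Reach (thetaGraph (4 * k + 3) S) x y (lengthBound (aperture (4 * k + 3))
        (coordY (bisectorAngle _ j) ((y : Plane) - x))
        |coordX 1 (bisectorAngle _ j) ((y : Plane) - x)|)) (v : P)
    (huv : (visibilityGraph S).Adj u v) (hv : (v : Plane) ∈ cone (4 * k + 3) i u)
    (hor : 0 < orient o u w v) (hno : NoConstraintIn S o u w v)
    (hvw : coordY (bisectorAngle _ i) v ≤ coordY (bisectorAngle _ i) w)
    (hlow : ∀ p : P, InAngle o u w v p →
      coordY (bisectorAngle _ i) v ≤ coordY (bisectorAngle _ i) p)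
    (hreach : Reach (thetaGraph (4 * k + 3) S) u v (lengthBound (aperture (4 * k + 3))
        (coordY (bisectorAngle _ i) ((v : Plane) - u)) (coordX o (bisectorAngle _ i) ((v : Plane) - u)))
      ∨ (Reach (thetaGraph (4 * k + 3) S) u v (lengthBound (aperture (4 * k + 3))
          (coordY (bisectorAngle _ i) ((v : Plane) - u))
          (-coordX o (bisectorAngle _ i) ((v : Plane) - u))) ∧
        ∀ p : P, p = w ∨ InAngle o u w v p →
          coordX o (bisectorAngle _ i) p ≤ coordX o (bisectorAngle _ i) v)) :
    Reach (thetaGraph (4 * k + 3) S) u w (lengthBound (aperture (4 * k + 3))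
      (coordY (bisectorAngle _ i) ((w : Plane) - u))
      |coordX o (bisectorAngle _ i) ((w : Plane) - u)|) := by
  have hm : 3 ≤ 4 * k + 3 := by omega
  have hSp := sin_half_aperture_pos hm
  have hCp := cos_half_aperture_pos hm
  have h0 : 0 < aperture (4 * k + 3) := by linarith [half_aperture_pos hm]
  have h7 := aperture_le hk
  have hoo : o * o = 1 := by rcases ho with rfl | rfl <;> norm_num
  have ho0 : o ≠ 0 := by rintro rfl; simp at hoo
  simp only [coordX_sub, coordY_sub] at hreach IH ⊢
  set θ := aperture (4 * k + 3)
  set φ := bisectorAngle _ i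
  have hwf : WellFounded fun a b : P => coordY φ b < coordY φ a :=
    @Finite.wellFounded_of_trans_of_irrefl _ _ _ ⟨fun _ _ _ h h' => h'.trans h⟩
      ⟨fun _ => lt_irrefl _⟩
  induction v using hwf.induction with
  | h v ih =>
  have hYuv : coordY φ u < coordY φ v :=
    lt_of_le_of_ne (coordY_nonneg_of_mem_cone hm hv) (coordY_ne hP huv.ne i)
  have hYuw : coordY φ u < coordY φ w := hYuv.trans_le hvw
  obtain ⟨v', hv', huv', hvv', hr1, hr2, hr3⟩ :=
    exists_next hP hS ho0 φ huv huw hor hno hYuv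
  have hall : ∀ q : P, q = w ∨ InAngle o u w v q →
      0 ≤ orient o v v' q ∧ coordY φ v ≤ coordY φ q := by
    rintro q (rfl | hq)
    · exact ⟨hr2, hvw⟩
    · exact ⟨hr3 q hq, hlow q hq⟩
  have hYvv' : coordY φ v < coordY φ v' :=
    lt_of_le_of_ne (hall v' hv').2 (coordY_ne hP hvv'.ne i)
  have hwv' : 0 ≤ orient o u w v' := by
    rcases hv' with rfl | h
    · rw [orient_self_right]
    · exact h.1.le
  have hv'w : coordY φ v' ≤ coordY φ w := by
    have hid : orient o u w v * (coordY φ w - coordY φ v') =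
        orient o v v' w * (coordY φ w - coordY φ u) +
          orient o u w v' * (coordY φ w - coordY φ v) := by
      simp only [orient_eq_coord o φ]; ring
    have h1 : 0 ≤ orient o u w v * (coordY φ w - coordY φ v') := by
      rw [hid]
      exact add_nonneg (mul_nonneg hr2 (by linarith)) (mul_nonneg hwv' (by linarith))
    linarith [nonneg_of_mul_nonneg_right h1 hor]
  have hv'c : (v' : Plane) ∈ cone (4 * k + 3) i u := by
    rcases hv' with rfl | h
    · exact hw
    · obtain ⟨α, β, hα, hβ, e⟩ := h.combo hor
      exact cone_combo hw hv hα.le hβ.le e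
  have hcv := (mem_cone_iff hm hoo i u v).1 hv
  have hcv' := (mem_cone_iff hm hoo i u v').1 hv'c
  rw [coordX_sub, coordY_sub] at hcv hcv'
  have hcv1 := (mul_le_mul_of_nonneg_right (neg_le_abs _) hCp.le).trans hcv
  have hcv1' := (mul_le_mul_of_nonneg_right (le_abs_self _) hCp.le).trans hcv'
  have hr1' := hr1
  rw [orient_eq_coord o φ] at hr1'
  have hright : coordX o φ v ≤ coordX o φ v' → Reach (thetaGraph (4 * k + 3) S) v v'
      (lengthBound θ (coordY φ v' - coordY φ v) (coordX o φ v' - coordX o φ v)) := by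
    intro hX
    obtain ⟨j, hj, hb, hsize⟩ := exists_cone_bound hk i ho (v := v) (v' := v')
      (by rw [coordX_sub]; linarith) (by rw [coordY_sub]; linarith)
    simp only [coordX_sub, coordY_sub] at hb hsize
    -- The width hypothesis holds because `v` is right of the left boundary of the cone of `u` and
    -- `v'` is left of the right one; H is the height of `v'` above `u`.
    exact (IH v v' hvv' j hj ((hsize (coordY φ v' - coordY φ u) (by linarith)
      (by linarith)).trans_le (by linarith))).mono hb
  have hleft : coordX o φ v' ≤ coordX o φ v → Reach (thetaGraph (4 * k + 3) S) v v'
      (lengthBound θ (coordY φ v' - coordY φ v) (-(coordX o φ v' - coordX o φ v))) := by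
    intro hX
    have habs : |coordX o φ v' - coordX o φ v| = -(coordX o φ v' - coordX o φ v) :=
      abs_of_nonpos (by linarith)
    have := IH v v' hvv' i ?_ (by linarith)
    · rwa [← coordX_sub 1, abs_coordX ho, coordX_sub, habs] at this
    · rw [mem_cone_iff hm hoo, coordX_sub, coordY_sub, habs]
      have := mul_sub_le hCp (sub_pos.2 hYuv) (by linarith) hcv1 hr1'
      linarith
  have hphase : Reach (thetaGraph (4 * k + 3) S) u v'
        (lengthBound θ (coordY φ v' - coordY φ u) (coordX o φ v' - coordX o φ u)) ∨
      (Reach (thetaGraph (4 * k + 3) S) u v'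
        (lengthBound θ (coordY φ v' - coordY φ u) (-(coordX o φ v' - coordX o φ u))) ∧
        coordX o φ v' ≤ coordX o φ v) := by
    rcases hreach with h1 | ⟨h2, hX⟩
    · rcases le_or_gt (coordX o φ v) (coordX o φ v') with hX | hX
      · left
        refine (h1.trans (hright hX)).mono ?_
        rw [lengthBound_add]
        exact le_of_eq (by congr 1 <;> ring)
      · right
        refine ⟨(h1.trans (hleft hX.le)).mono ?_, hX.le⟩
        rw [lengthBound_add, show coordY φ v - coordY φ u + (coordY φ v' - coordY φ v) =
          coordY φ v' - coordY φ u by ring]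
        refine lengthBound_mono h0 h7 ?_
        -- The edge `vv'` leans left and `w` is on its left, so `w` is left of `v`. As `w` is also
        -- clockwise of `v` around `u` and no lower, `v` cannot be right of `u`. This pays for the
        -- change of sign.
        have hXw : coordX o φ w ≤ coordX o φ v := by
          have h3 := hr2
          rw [orient_eq_coord o φ] at h3
          by_contra! hlt
          nlinarith [mul_nonneg (sub_nonneg.2 hX.le) (sub_nonneg.2 hvw),
            mul_pos (sub_pos.2 hYvv') (sub_pos.2 hlt)]
        have hXv : coordX o φ v ≤ coordX o φ u := by
          have h3 := hor
          rw [orient_eq_coord o φ] at h3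
          by_contra! hlt
          nlinarith [mul_nonneg (sub_nonneg.2 hlt.le) (sub_nonneg.2 hvw),
            mul_nonneg (sub_nonneg.2 hYuv.le) (sub_nonneg.2 hXw)]
        linarith
    · right
      refine ⟨(h2.trans (hleft (hX v' hv'))).mono ?_, hX v' hv'⟩
      rw [lengthBound_add]
      exact le_of_eq (by congr 1 <;> ring)
  rcases hv' with rfl | hin
  · rcases hphase with h | ⟨h, -⟩
    · exact h.mono (lengthBound_mono h0 h7 (le_abs_self _))
    · exact h.mono (lengthBound_mono h0 h7 (neg_le_abs _))
  · have hsub : ∀ p : Plane, InAngle o u w v' p → InAngle o u w v p := by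
      intro p hp
      refine ⟨hp.1, ?_⟩
      have hid : orient o u w v' * orient o u p v =
          orient o u p v' * orient o u w v + orient o u w p * orient o u v' v := by
        simp only [orient, cross]; ring
      have h1 : 0 < orient o u w v' * orient o u p v := by
        rw [hid]
        exact add_pos (mul_pos hp.2 hor) (mul_pos hp.1 hr1)
      exact (mul_pos_iff_of_pos_left hin.1).1 h1
    -- A vertex of the smaller angle is on the far side of the climbing edge `vv'` and clockwise of
    -- `v'`, hence not below `v'`.
    have hlow' : ∀ p : P, InAngle o u w v' p → coordY φ v' ≤ coordY φ p := by
      intro p hp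
      have hid : orient o u v' v * (coordY φ p - coordY φ v') =
          orient o v v' p * (coordY φ v' - coordY φ u) +
            orient o u p v' * (coordY φ v' - coordY φ v) := by
        simp only [orient_eq_coord o φ]; ring
      have h1 : 0 ≤ orient o u v' v * (coordY φ p - coordY φ v') := by
        rw [hid]
        exact add_nonneg (mul_nonneg (hr3 p (hsub p hp)) (by linarith))
          (mul_nonneg hp.2.le (by linarith))
      linarith [nonneg_of_mul_nonneg_right h1 hr1]
    refine ih v' hYvv' huv' hv'c hin.1 (fun b hb hb' => hno b hb (hsub b hb')) hv'w hlow' ?_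
    refine hphase.imp id fun ⟨h, hX⟩ => ⟨h, fun q hq => ?_⟩
    have h1 : 0 ≤ orient o v v' q := (hall q (hq.imp id (hsub q))).1
    have h2 : coordY φ v' ≤ coordY φ q := by
      rcases hq with rfl | hq
      · exact hv'w
      · exact hlow' q hq
    rw [orient_eq_coord o φ] at h1
    by_contra! hlt
    nlinarith [mul_nonneg (sub_nonneg.2 hX) (sub_nonneg.2 h2),
      mul_pos (sub_pos.2 hYvv') (sub_pos.2 hlt)]

theorem norm_sq_eq_coord (φ : ℝ) (d : Plane) : ‖d‖ ^ 2 = coordY φ d ^ 2 + coordX 1 φ d ^ 2 := by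
  rw [EuclideanSpace.norm_sq_eq, Fin.sum_univ_two]
  simp only [Real.norm_eq_abs, sq_abs, coordY, coordX]
  linear_combination (-(d 0 ^ 2 + d 1 ^ 2)) * Real.sin_sq_add_cos_sq φ

/-- A segment in a cone is no longer than the side of its canonical triangle. -/
theorem dist_le_lengthBound (hk : 1 ≤ k) (i : Fin (4 * k + 3)) {o : ℝ} (ho : o = 1 ∨ o = -1)
    {u v : Plane} (hv : v ∈ cone (4 * k + 3) i u) :
    dist u v ≤ lengthBound (aperture (4 * k + 3)) (coordY (bisectorAngle _ i) (v - u))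
      (coordX o (bisectorAngle _ i) (v - u)) := by
  have hm : 3 ≤ 4 * k + 3 := by omega
  have hSp := sin_half_aperture_pos hm
  have hCp := cos_half_aperture_pos hm
  have h0 : 0 < aperture (4 * k + 3) := by linarith [half_aperture_pos hm]
  have hc := (stretch_spec h0 (aperture_le hk)).2.2
  have h1 := (mem_cone_iff hm (one_mul 1) i u v).1 hv
  have hn := norm_sq_eq_coord (bisectorAngle _ i) (v - u)
  rw [dist_comm, dist_eq_norm]
  have hY : 0 ≤ coordY (bisectorAngle _ i) (v - u) := by
    rw [coordY_sub]; linarith [coordY_nonneg_of_mem_cone hm hv]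
  have h2 : ‖v - u‖ * Real.cos (aperture (4 * k + 3) / 2) ≤
      coordY (bisectorAngle _ i) (v - u) := by
    refine abs_le_of_sq_le_sq' ?_ hY |>.2
    have h3 := pow_le_pow_left₀ (by positivity) h1 2
    rw [mul_pow, sq_abs] at h3
    have h4 := Real.sin_sq_add_cos_sq (aperture (4 * k + 3) / 2)
    rw [mul_pow, hn]
    nlinarith
  have h5 : 0 ≤ coordY (bisectorAngle _ i) (v - u) * Real.tan (aperture (4 * k + 3) / 2) +
      coordX o (bisectorAngle _ i) (v - u) := by
    rw [abs_coordX ho] at h1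
    have h6 := (mul_le_mul_of_nonneg_right (neg_le_abs _) hCp.le).trans h1
    rw [Real.tan_eq_sin_div_cos, ← mul_div_assoc, div_add' _ _ _ hCp.ne']
    exact div_nonneg (by linarith) hCp.le
  unfold lengthBound
  have h6 := mul_nonneg hc.le h5
  have h7 := (le_div_iff₀ hCp).2 h2
  linarith

/-- Induction on the height of the canonical triangle. The cone index belongs to the induction
variable because chain edges can lie in other cones; finitely many triples make the order
well-founded. -/
theorem reach_of_visible (hk : 1 ≤ k) (hP : GeneralPosition (4 * k + 3) P)
    (hS : PlanarConstraints S) (T : P × P × Fin (4 * k + 3))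
    (huw : (visibilityGraph S).Adj T.1 T.2.1)
    (hw : (T.2.1 : Plane) ∈ cone (4 * k + 3) T.2.2 T.1) :
    Reach (thetaGraph (4 * k + 3) S) T.1 T.2.1 (lengthBound (aperture (4 * k + 3))
      (coordY (bisectorAngle _ T.2.2) ((T.2.1 : Plane) - T.1))
      |coordX 1 (bisectorAngle _ T.2.2) ((T.2.1 : Plane) - T.1)|) := by
  have hwf : WellFounded fun a b : P × P × Fin (4 * k + 3) =>
      coordY (bisectorAngle _ a.2.2) ((a.2.1 : Plane) - a.1) <
        coordY (bisectorAngle _ b.2.2) ((b.2.1 : Plane) - b.1) :=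
    @Finite.wellFounded_of_trans_of_irrefl _ _ _ ⟨fun _ _ _ h h' => h.trans h'⟩
      ⟨fun _ => lt_irrefl _⟩
  induction T using hwf.induction with
  | h T ih =>
  obtain ⟨u, w, i⟩ := T
  dsimp only at huw hw ih ⊢
  have hm : 3 ≤ 4 * k + 3 := by omega
  have h0 : 0 < aperture (4 * k + 3) := by linarith [half_aperture_pos hm]
  obtain ⟨v, hadd, huv, hv, hvw, hlow⟩ := exists_closest hm hP hS i huw hw
  have hadj : (thetaGraph (4 * k + 3) S).Adj u v := Or.inl hadd
  by_cases hvw' : v = w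
  · subst hvw'
    exact (Reach.of_adj hadj).mono ((dist_le_lengthBound hk i (Or.inl rfl) hv).trans
      (lengthBound_mono h0 (aperture_le hk) (le_abs_self _)))
  · obtain ⟨o, ho, hor⟩ : ∃ o : ℝ, (o = 1 ∨ o = -1) ∧ 0 < orient o u w v := by
      rcases lt_or_gt_of_ne (orient_ne_zero hP one_ne_zero huw.ne huv.ne (Ne.symm hvw'))
        with h | h
      · exact ⟨-1, Or.inr rfl, by rw [orient_neg]; linarith⟩
      · exact ⟨1, Or.inl rfl, h⟩
    obtain ⟨hno, hlow⟩ := hlow o (by rcases ho with rfl | rfl <;> norm_num) hor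
    rw [abs_coordX ho]
    exact reach_of_chain hk hP hS i ho huw hw (fun x y hxy j hj hlt => ih (x, y, j) hlt hxy hj)
      v huv hv hor hno hvw hlow
      -- The first edge fits the bound with signed width, even when `v` is left of the bisector: its
      -- length is at most y / cos(θ/2), and y tan(θ/2) + x is nonnegative in the cone.
      (Or.inl ((Reach.of_adj hadj).mono (dist_le_lengthBound hk i ho hv)))

end Chain

/-! ### From cone coordinates to the angle α -/

theorem oppositeMidpoint_sub {m : ℕ} (hm : 3 ≤ m) (i : Fin m) (u w : Plane) :
    oppositeMidpoint m i u w - u =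
      coordY (bisectorAngle m i) (w - u) • dir (bisectorAngle m i) := by
  have hc := (cos_half_aperture_pos hm).ne'
  have h : leftRay m i + rightRay m i =
      (2 * Real.cos (aperture m / 2)) • dir (bisectorAngle m i) := by
    ext j
    fin_cases j
    · simp [leftRay, rightRay, dir, bisectorAngle, Real.sin_sub, Real.sin_add]; ring
    · simp [leftRay, rightRay, dir, bisectorAngle, Real.cos_sub, Real.cos_add]; ring
  rw [oppositeMidpoint, midpoint_eq_smul_add, leftCorner, rightCorner, inner_bisector]
  set y := coordY (bisectorAngle m i) (w - u)
  have h2 : (⅟2 : ℝ) • (u + (y / Real.cos (aperture m / 2)) • leftRay m i +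
      (u + (y / Real.cos (aperture m / 2)) • rightRay m i)) - u =
      (⅟2 * (y / Real.cos (aperture m / 2))) • (leftRay m i + rightRay m i) := by
    rw [invOf_eq_inv]; module
  rw [h2, h, smul_smul, invOf_eq_inv]
  congr 1
  field_simp

end ConstrainedTheta

open ConstrainedTheta in
theorem mainTheorem7 (k : ℕ) (hk : 1 ≤ k) (θ : ℝ)
    (hθ : θ = ConstrainedTheta.aperture (4 * k + 3))
    (P : Finset ConstrainedTheta.Plane)
    (hP : ConstrainedTheta.GeneralPosition (4 * k + 3) P)
    (S : SimpleGraph P) (hS : ConstrainedTheta.PlanarConstraints S)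
    (u w : P) (huw : (ConstrainedTheta.visibilityGraph S).Adj u w)
    (i : Fin (4 * k + 3)) (hi : (w : ConstrainedTheta.Plane) ∈ ConstrainedTheta.cone (4 * k + 3) i u)
    (α : ℝ)
    (hα : α = EuclideanGeometry.angle (w : ConstrainedTheta.Plane) (u : ConstrainedTheta.Plane)
      (ConstrainedTheta.oppositeMidpoint (4 * k + 3) i u w)) :
    ∃ p : (ConstrainedTheta.thetaGraph (4 * k + 3) S).Walk u w, p.IsPath ∧
      ConstrainedTheta.walkLength p ≤
        (Real.cos α / Real.cos (θ / 2) +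
          (Real.cos α * Real.tan (θ / 2) + Real.sin α) * Real.cos (θ / 4) /
            (Real.cos (θ / 2) - Real.sin (3 * θ / 4))) *
        dist (u : ConstrainedTheta.Plane) (w : ConstrainedTheta.Plane) := by
  have hm : 3 ≤ 4 * k + 3 := by omega
  have h := reach_of_visible hk hP hS (u, w, i) huw hi
  refine (h.mono (le_of_eq ?_)).exists_isPath
  dsimp only
  set φ := bisectorAngle _ i with hφ
  set d : Plane := (w : Plane) - u with hd
  have hY : 0 < coordY φ d := by
    rw [hd, coordY_sub]
    exact sub_pos.2 (lt_of_le_of_ne (coordY_nonneg_of_mem_cone hm hi) (coordY_ne hP huw.ne i))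
  have hα' : α = InnerProductGeometry.angle d (dir φ) := by
    rw [hα, EuclideanGeometry.angle, vsub_eq_sub, vsub_eq_sub, oppositeMidpoint_sub hm,
      ← hd, ← hφ, InnerProductGeometry.angle_smul_right_of_pos _ _ hY]
  have hdir : ‖dir φ‖ = 1 := by
    rw [norm_eq_sqrt_real_inner, inner_dir_dir]; simp
  -- The midpoint lies on the bisector ray, so |uw| cos α and |uw| sin α are the height and the
  -- absolute width of `w` in the cone.
  have hcos : Real.cos α * ‖d‖ = coordY φ d := by
    have := InnerProductGeometry.cos_angle_mul_norm_mul_norm d (dir φ)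
    rw [hdir, mul_one, real_inner_comm, inner_dir] at this
    rw [hα', this]
  have hsin : Real.sin α * ‖d‖ = |coordX 1 φ d| := by
    have h1 : 0 ≤ Real.sin α := by rw [hα']; exact InnerProductGeometry.sin_angle_nonneg _ _
    rw [← abs_of_nonneg (mul_nonneg h1 (norm_nonneg d)), ← sq_eq_sq_iff_abs_eq_abs]
    have h2 := norm_sq_eq_coord φ d
    have h3 := Real.sin_sq_add_cos_sq α
    rw [← hcos] at h2
    linear_combination ‖d‖ ^ 2 * h3 + h2
  rw [dist_comm, dist_eq_norm, ← hd, ← hcos, ← hsin, hθ, lengthBound, stretch]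
  ring
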